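/- Let $n\ge 1$, let $\mathcal H_C,\mathcal H_A$ be complex Hilbert spaces and $|\psi\rangle\in\mathcal H_C\otimes\mathcal H_A$ a unit vector. For each $\mathbf z\in\{1,2,3\}^n$ let $\{\Pi^C_{\mathbf c|\mathbf z}\}_{\mathbf c\in\{\pm1\}^n}$ be a projective measurement on $\mathcal H_C$, and for each $\mathbf x\in\{1,\dots,6\}^n$ let $\{\Pi^A_{\mathbf a|\mathbf x}\}_{\mathbf a\in\{\pm1\}^n}$ be a projective measurement on $\mathcal H_A$. For $i=1,\dots,n$ put $$\mathsf O_{i|\mathbf z}=\sum_{\mathbf c:\,c_i=+1}\Pi^C_{\mathbf c|\mathbf z}-\sum_{\mathbf c:\,c_i=-1}\Pi^C_{\mathbf c|\mathbf z},\qquad \mathsf P_{i|\mathbf x}=\sum_{\mathbf a:\,a_i=+1}\Pi^A_{\mathbf a|\mathbf x}-\sum_{\mathbf a:\,a_i=-1}\Pi^A_{\mathbf a|\mathbf x}.$$ Let $\mathsf Z_i,\mathsf X_i,\mathsf Y_i$ be the averages $\frac1{3^{n-1}}\sum_{\mathbf z:\,z_i=s}\mathsf O_{i|\mathbf z}$ for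 $s=1,2,3$ respectively, and let $\mathsf D_{zx,i},\mathsf E_{zx,i},\mathsf D_{zy,i},\mathsf E_{zy,i},\mathsf D_{xy,i},\mathsf E_{xy,i}$ be the averages $\frac1{6^{n-1}}\sum_{\mathbf x:\,x_i=s}\mathsf P_{i|\mathbf x}$ for $s=1,2,3,4,5,6$ respectively. Define $$\begin{aligned}\mathcal B_i={}&\mathsf Z_i\otimes(\mathsf D_{zx,i}+\mathsf E_{zx,i})+\mathsf X_i\otimes(\mathsf D_{zx,i}-\mathsf E_{zx,i})+\mathsf Z_i\otimes(\mathsf D_{zy,i}+\mathsf E_{zy,i})-\mathsf Y_i\otimes(\mathsf D_{zy,i}-\mathsf E_{zy,i})\\&+\mathsf X_i\otimes(\mathsf D_{xy,i}+\mathsf E_{xy,i})-\mathsf Y_i\otimes(\mathsf D_{xy,i}-\mathsf E_{xy,i}).\end{aligned}$$ Suppose that $\langle\psi|\mathcal B_i|\psi\rangle=6\sqrt2$ for every $i\in\{1,\dots,n\}$. Let $C'',C',A'',A'$ be auxiliary registers of $n$ qubits each, with $j$-th qubits $C_j'',C_j',A_j'',A_j'$, and let $|00\rangle$ be the state in which all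 these qubits are $|0\rangle$. Let $|\Phi^+\rangle=\frac1{\sqrt2}(|00\rangle+|11\rangle)$ and let $\sigma_x,\sigma_y,\sigma_z$ be the Pauli matrices. Then there are a local unitary $U=U_C\otimes U_A$, with $U_C$ a unitary on $\mathcal H_C\otimes\mathcal H_{C''}\otimes\mathcal H_{C'}$ and $U_A$ a unitary on $\mathcal H_A\otimes\mathcal H_{A''}\otimes\mathcal H_{A'}$, and a normalized state $|\xi\rangle\in\mathcal H_C\otimes\mathcal H_A\otimes\mathcal H_{C''}\otimes\mathcal H_{A''}$ of the form $$|\xi\rangle=\sum_{\bar q\in\{0,1\}^n}|\xi_{\bar q}\rangle^{CA}\otimes|\bar q\,\bar q\rangle^{C''A''},\qquad|\xi_{\bar q}\rangle\in\mathcal H_C\otimes\mathcal H_A,$$ such that $$U\big[|\psi\rangle\otimes|00\rangle\big]=|\xi\rangle\otimes\bigotimes_{i=1}^n|\Phi^+\rangle^{C_i'A_i'}$$ and, for every $j\in\{1,\dots,n\}$, $$\begin{aligned} U\big[\mathsf Z_j|\psi\rangle\otimes|00\rangle\big]&=|\xi\rangle\otimes\sigma_z^{C_j'}\bigotimes_{i=1}^n|\Phi^+\rangle^{C_i'A_i'},\\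 U\big[\mathsf X_j|\psi\rangle\otimes|00\rangle\big]&=|\xi\rangle\otimes\sigma_x^{C_j'}\bigotimes_{i=1}^n|\Phi^+\rangle^{C_i'A_i'},\\ U\big[\mathsf Y_j|\psi\rangle\otimes|00\rangle\big]&=\sigma_z^{C_j''}|\xi\rangle\otimes\sigma_y^{C_j'}\bigotimes_{i=1}^n|\Phi^+\rangle^{C_i'A_i'}. \end{aligned}$$ -/

import Mathlib

open scoped TensorProduct

noncomputable section

namespace PauliSelfTest

/-! ### Hilbert space tensor products -/

section HilbertTensor

/-- The Hilbert space tensor product: the completion of the algebraic tensor product for the inner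
product `⟪a ⊗ b, c ⊗ d⟫ = ⟪a, c⟫ * ⟪b, d⟫`. -/
def HTensor (E F : Type*) [NormedAddCommGroup E] [InnerProductSpace ℂ E]
    [NormedAddCommGroup F] [InnerProductSpace ℂ F] : Type _ :=
  UniformSpace.Completion (E ⊗[ℂ] F)

variable {E F G H : Type*}
  [NormedAddCommGroup E] [InnerProductSpace ℂ E]
  [NormedAddCommGroup F] [InnerProductSpace ℂ F]
  [NormedAddCommGroup G] [InnerProductSpace ℂ G]
  [NormedAddCommGroup H] [InnerProductSpace ℂ H]

instance : NormedAddCommGroup (HTensor E F) :=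
  inferInstanceAs (NormedAddCommGroup (UniformSpace.Completion (E ⊗[ℂ] F)))

instance : InnerProductSpace ℂ (HTensor E F) :=
  inferInstanceAs (InnerProductSpace ℂ (UniformSpace.Completion (E ⊗[ℂ] F)))

instance : CompleteSpace (HTensor E F) :=
  inferInstanceAs (CompleteSpace (UniformSpace.Completion (E ⊗[ℂ] F)))

/-- The canonical isometric embedding of the algebraic tensor product, with dense range. -/
def ofAlg : (E ⊗[ℂ] F) →ₗᵢ[ℂ] HTensor E F :=
  (UniformSpace.Completion.toComplₗᵢ : (E ⊗[ℂ] F) →ₗᵢ[ℂ] UniformSpace.Completion (E ⊗[ℂ] F))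

theorem denseRange_ofAlg : DenseRange (ofAlg : (E ⊗[ℂ] F) → HTensor E F) :=
  UniformSpace.Completion.denseRange_coe

/-- The tensor product `f ⊗ g` of two bounded operators: the bounded operator with
`(f ⊗ g) (x ⊗ y) = f x ⊗ g y`. -/
def hmap (f : E →L[ℂ] F) (g : G →L[ℂ] H) : HTensor E G →L[ℂ] HTensor F H :=
  ((TensorProduct.mapL f g).completion :
    UniformSpace.Completion (E ⊗[ℂ] G) →L[ℂ] UniformSpace.Completion (F ⊗[ℂ] H))

theorem hmap_ofAlg (f : E →L[ℂ] F) (g : G →L[ℂ] H) (x : E ⊗[ℂ] G) :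
    hmap f g (ofAlg x) = ofAlg (TensorProduct.mapL f g x) :=
  ContinuousLinearMap.completion_apply_coe (TensorProduct.mapL f g) x

/-- The product vector `x ⊗ y`. -/
def htmul (x : E) (y : F) : HTensor E F := ofAlg (x ⊗ₜ[ℂ] y)

/-- The bounded operator `x ↦ x ⊗ y`. -/
def tensorRight (y : F) : E →L[ℂ] HTensor E F :=
  ofAlg.toContinuousLinearMap.comp ((TensorProduct.mkL ℂ E F).flip y)

theorem hmap_htmul (f : E →L[ℂ] F) (g : G →L[ℂ] H) (x : E) (y : G) :
    hmap f g (htmul x y) = htmul (f x) (g y) :=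
  hmap_ofAlg f g (x ⊗ₜ[ℂ] y)

theorem tensorRight_apply (x : E) (y : F) : tensorRight y x = htmul x y := rfl

end HilbertTensor

/-! ### Measurements and observables -/

section Measurements

variable {H : Type*} [NormedAddCommGroup H] [InnerProductSpace ℂ H] [CompleteSpace H] {n : ℕ}

/-- A projective measurement with finitely many outcomes: orthogonal projections that sum to the
identity (such projections are automatically mutually orthogonal). -/
structure IsProjectiveMeasurement {O : Type*} [Fintype O] (P : O → (H →L[ℂ] H)) : Prop where
  isStarProjection : ∀ c, IsStarProjection (P c)
  sum_eq_one : ∑ c, P c = 1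

/-- The `±1`-valued observable that reads off the `i`-th of the `n` outcomes `c_i = ±1`:
`∑_{c | c_i = +1} P_c - ∑_{c | c_i = -1} P_c`. -/
def outcomeObs (P : (Fin n → ℤˣ) → (H →L[ℂ] H)) (i : Fin n) : H →L[ℂ] H :=
  (∑ c with c i = 1, P c) - ∑ c with c i = -1, P c

/-- For a family of measurements indexed by the input vectors `z = (z_1, …, z_n)`, each `z_i`
having `m` values: the average of the observables `outcomeObs (P z) i` over the `m ^ (n - 1)`
inputs `z` with `z_i = s`. -/
def avgObs {m : ℕ} (P : (Fin n → Fin m) → (Fin n → ℤˣ) → (H →L[ℂ] H)) (i : Fin n) (s : Fin m) :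
    H →L[ℂ] H :=
  ((m : ℂ) ^ (n - 1))⁻¹ • ∑ z with z i = s, outcomeObs (P z) i

/-- Charlie's averaged observables `Z_i`, `X_i`, `Y_i`. His inputs `z_i = 1, 2, 3` are the
elements `0, 1, 2` of `Fin 3`. -/
def Zop (P : (Fin n → Fin 3) → (Fin n → ℤˣ) → (H →L[ℂ] H)) (i : Fin n) : H →L[ℂ] H := avgObs P i 0
/-- See `Zop`. -/
def Xop (P : (Fin n → Fin 3) → (Fin n → ℤˣ) → (H →L[ℂ] H)) (i : Fin n) : H →L[ℂ] H := avgObs P i 1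
/-- See `Zop`. -/
def Yop (P : (Fin n → Fin 3) → (Fin n → ℤˣ) → (H →L[ℂ] H)) (i : Fin n) : H →L[ℂ] H := avgObs P i 2

/-- Alice's averaged observables `D_{zx,i}`, `E_{zx,i}`, `D_{zy,i}`, `E_{zy,i}`, `D_{xy,i}`,
`E_{xy,i}`. Her inputs `x_i = 1, …, 6` are the elements `0, …, 5` of `Fin 6`. -/
def Dzx (P : (Fin n → Fin 6) → (Fin n → ℤˣ) → (H →L[ℂ] H)) (i : Fin n) : H →L[ℂ] H := avgObs P i 0
/-- See `Dzx`. -/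
def Ezx (P : (Fin n → Fin 6) → (Fin n → ℤˣ) → (H →L[ℂ] H)) (i : Fin n) : H →L[ℂ] H := avgObs P i 1
/-- See `Dzx`. -/
def Dzy (P : (Fin n → Fin 6) → (Fin n → ℤˣ) → (H →L[ℂ] H)) (i : Fin n) : H →L[ℂ] H := avgObs P i 2
/-- See `Dzx`. -/
def Ezy (P : (Fin n → Fin 6) → (Fin n → ℤˣ) → (H →L[ℂ] H)) (i : Fin n) : H →L[ℂ] H := avgObs P i 3
/-- See `Dzx`. -/
def Dxy (P : (Fin n → Fin 6) → (Fin n → ℤˣ) → (H →L[ℂ] H)) (i : Fin n) : H →L[ℂ] H := avgObs P i 4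
/-- See `Dzx`. -/
def Exy (P : (Fin n → Fin 6) → (Fin n → ℤˣ) → (H →L[ℂ] H)) (i : Fin n) : H →L[ℂ] H := avgObs P i 5

variable {HC HA : Type*} [NormedAddCommGroup HC] [InnerProductSpace ℂ HC] [CompleteSpace HC]
  [NormedAddCommGroup HA] [InnerProductSpace ℂ HA] [CompleteSpace HA]

/-- The averaged triple CHSH Bell operator `B_i` on the joint space of Charlie and Alice. -/
def bellOp (PC : (Fin n → Fin 3) → (Fin n → ℤˣ) → (HC →L[ℂ] HC))
    (PA : (Fin n → Fin 6) → (Fin n → ℤˣ) → (HA →L[ℂ] HA)) (i : Fin n) :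
    HTensor HC HA →L[ℂ] HTensor HC HA :=
  hmap (Zop PC i) (Dzx PA i + Ezx PA i) + hmap (Xop PC i) (Dzx PA i - Ezx PA i)
    + hmap (Zop PC i) (Dzy PA i + Ezy PA i) - hmap (Yop PC i) (Dzy PA i - Ezy PA i)
    + hmap (Xop PC i) (Dxy PA i + Exy PA i) - hmap (Yop PC i) (Dxy PA i - Exy PA i)

end Measurements

/-! ### Qubit registers -/

section Registers

/-- Bit strings of length `n`. -/
abbrev Bits (n : ℕ) : Type := Fin n → Fin 2

/-- A register of `n` qubits, `(ℂ²)^{⊗ n}` with its computational basis `|b⟩`, `b ∈ {0,1}^n`. -/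
abbrev Register (n : ℕ) : Type := EuclideanSpace ℂ (Bits n)

/-- The computational basis vector `|b⟩`. -/
def ket {n : ℕ} (b : Bits n) : Register n := EuclideanSpace.single b 1

/-- The joint space of two registers of `n` qubits, with its computational basis `|b b'⟩`. -/
abbrev TwoRegisters (n : ℕ) : Type := EuclideanSpace ℂ (Bits n × Bits n)

/-- The computational basis vector `|b b'⟩` of two registers. -/
def ket₂ {n : ℕ} (b b' : Bits n) : TwoRegisters n := EuclideanSpace.single (b, b') 1

/-- The Pauli matrix `σ_x`. -/
def σx : Matrix (Fin 2) (Fin 2) ℂ := !![0, 1; 1, 0]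
/-- The Pauli matrix `σ_y`. -/
def σy : Matrix (Fin 2) (Fin 2) ℂ := !![0, -Complex.I; Complex.I, 0]
/-- The Pauli matrix `σ_z`. -/
def σz : Matrix (Fin 2) (Fin 2) ℂ := !![1, 0; 0, -1]

/-- The one-qubit operator `σ` acting on the `j`-th qubit of a register, and as the identity on
the other qubits. -/
def onQubit {n : ℕ} (σ : Matrix (Fin 2) (Fin 2) ℂ) (j : Fin n) : Register n →L[ℂ] Register n :=
  Matrix.toEuclideanCLM (n := Bits n) (𝕜 := ℂ)
    (Matrix.of fun b b' => if ∀ i, i ≠ j → b i = b' i then σ (b j) (b' j) else 0)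

/-- The amplitudes `⟨ab|Φ⁺⟩` of `|Φ⁺⟩ = (|00⟩ + |11⟩) / √2`. -/
def phiPlus (a b : Fin 2) : ℂ := if a = b then ((√2 : ℝ) : ℂ)⁻¹ else 0

/-- The state `⨂_i |Φ⁺⟩` of two registers, the `i`-th factor being shared by the `i`-th qubits of
the two registers. -/
def phiPlusPow (n : ℕ) : TwoRegisters n :=
  WithLp.toLp 2 fun b => ∏ i, phiPlus (b.1 i) (b.2 i)

variable {E F : Type*} [NormedAddCommGroup E] [InnerProductSpace ℂ E]
  [NormedAddCommGroup F] [InnerProductSpace ℂ F] {n : ℕ}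

/-- For a bipartite vector `v ∈ E ⊗ F` and a state `χ` of two registers, the vector `v ⊗ χ`, with
the first register handed to the owner of `E` and the second to the owner of `F`: the tensor factors
are arranged as `(E ⊗ Register n) ⊗ (F ⊗ Register n)`. -/
def attach (v : HTensor E F) (χ : TwoRegisters n) :
    HTensor (HTensor E (Register n)) (HTensor F (Register n)) :=
  ∑ b : Bits n, ∑ b' : Bits n,
    χ (b, b') • hmap (tensorRight (ket b)) (tensorRight (ket b')) v

/-- The one-qubit operator `σ` acting on the `j`-th qubit of the (outermost) register of the first
party. -/
def onCharlieQubit (σ : Matrix (Fin 2) (Fin 2) ℂ) (j : Fin n) :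
    HTensor (HTensor E (Register n)) F →L[ℂ] HTensor (HTensor E (Register n)) F :=
  hmap (hmap (ContinuousLinearMap.id ℂ E) (onQubit σ j)) (ContinuousLinearMap.id ℂ F)

/-- A party's space `H` together with its two auxiliary registers,
`H ⊗ H'' ⊗ H'` with `H'' = H' = (ℂ²)^{⊗ n}`. -/
abbrev Extended (H : Type*) [NormedAddCommGroup H] [InnerProductSpace ℂ H] (n : ℕ) : Type _ :=
  HTensor (HTensor H (Register n)) (Register n)

/-- `v ⊗ |00⟩`, all qubits of all four registers `C''`, `A''`, `C'`, `A'` being in the state `|0⟩`.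
-/
def withZeros (n : ℕ) (v : HTensor E F) : HTensor (Extended E n) (Extended F n) :=
  attach (attach v (ket₂ (n := n) 0 0)) (ket₂ (n := n) 0 0)

end Registers

end PauliSelfTest

end

open PauliSelfTest

/-! Each `bellOp` is a sum of three CHSH operators, for Charlie's pairs `(Z, X)`, `(Z, -Y)` and `(X,
-Y)`. On `ψ` all averaged observables are contractions, so each CHSH value is at most `2√2`, and the
total `6√2` forces all three to be maximal. Tsirelson's sum of squares (`chsh_identity`) then gives
`√2 Zψ = (D + E)ψ` and its analogues, and shows that the averaged vectors are unit vectors.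

An average of unit vectors has norm one only if all of them coincide (`eq_average_of_norm_eq_one`).
Hence on `ψ` an averaged observable may be replaced by the genuine `±1` observable for any input
with the right entry: it squares to one on `ψ`, and observables for different indices commute on
`ψ`, since one joint measurement yields both. Anticommutation comes from squaring `(S + T)ψ = √2
Dψ`. This is `isCorrelatedPauli_of_bellOp`.

Every operator of Charlie has a partner of Alice with the same action on `ψ`. Relations on `ψ`
therefore become operator identities on the support of the reduced state (`exists_isPauliSystem`).
They determine the Pauli algebra except for the sign of `σ_y`; this sign is the central involution
`chirality`, and `Y = i·chirality·X·Z`.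

A product of controlled gates (`exists_unitary_swap`) swaps the Pauli algebra into the primed
register and copies the chirality into the doubly primed one. Afterwards the `σ_z` and `σ_x` of the
two primed registers agree on the state, which forces `⨂ Φ⁺` (`eq_attach_phiPlusPow`). The
chiralities agree too, so the remaining state `ξ` is diagonal in the doubly primed registers
(`eq_sum_attach_of_σz`). -/

namespace PauliSelfTest

/-! ### Operators on the Hilbert space tensor product -/

section HilbertTensorAlgebra

variable {E F G H E' F' : Type*}
  [NormedAddCommGroup E] [InnerProductSpace ℂ E]
  [NormedAddCommGroup F] [InnerProductSpace ℂ F]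
  [NormedAddCommGroup G] [InnerProductSpace ℂ G]
  [NormedAddCommGroup H] [InnerProductSpace ℂ H]
  [NormedAddCommGroup E'] [InnerProductSpace ℂ E']
  [NormedAddCommGroup F'] [InnerProductSpace ℂ F']

/-- Bounded operators on a Hilbert tensor product are determined by their values on product
vectors. -/
theorem clm_ext_htmul {f g : HTensor E F →L[ℂ] G}
    (h : ∀ x y, f (htmul x y) = g (htmul x y)) : f = g := by
  refine DFunLike.coe_injective (denseRange_ofAlg.equalizer f.continuous g.continuous ?_)
  funext t
  induction t using TensorProduct.induction_on with
  | zero => simp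
  | tmul x y => exact h x y
  | add a b ha hb => simpa using congrArg₂ (· + ·) ha hb

theorem inner_htmul (x x' : E) (y y' : F) :
    inner ℂ (htmul x y) (htmul x' y') = inner ℂ x x' * inner ℂ y y' := by
  simp [htmul]

/-- Product vectors span a dense subspace, so the bounded functional `⟪v, ·⟫` vanishes, in
particular at `v`. -/
theorem eq_zero_of_inner_htmul {v : HTensor E F}
    (h : ∀ x y, inner ℂ (htmul x y) v = 0) : v = 0 := by
  have : innerSL ℂ v = 0 := clm_ext_htmul fun x y => by
    simpa using inner_eq_zero_symm.1 (h x y)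
  have h0 : inner ℂ v v = 0 := congrArg (· v) this
  exact inner_self_eq_zero.1 h0

theorem htmul_add_left (x x' : E) (y : F) : htmul (x + x') y = htmul x y + htmul x' y := by
  simp [htmul, TensorProduct.add_tmul]

theorem htmul_add_right (x : E) (y y' : F) : htmul x (y + y') = htmul x y + htmul x y' := by
  simp [htmul, TensorProduct.tmul_add]

theorem htmul_smul_left (c : ℂ) (x : E) (y : F) : htmul (c • x) y = c • htmul x y := by
  rw [htmul, ← TensorProduct.smul_tmul', map_smul, htmul]

theorem htmul_smul_right (c : ℂ) (x : E) (y : F) : htmul x (c • y) = c • htmul x y := by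
  simp [htmul]

theorem htmul_sum_right {κ : Type*} (s : Finset κ) (x : E) (y : κ → F) :
    htmul x (∑ k ∈ s, y k) = ∑ k ∈ s, htmul x (y k) := by
  simp [htmul, TensorProduct.tmul_sum]

theorem hmap_comp (f' : F →L[ℂ] E') (f : E →L[ℂ] F) (g' : H →L[ℂ] F') (g : G →L[ℂ] H) :
    hmap (f' ∘L f) (g' ∘L g) = hmap f' g' ∘L hmap f g :=
  clm_ext_htmul fun x y => by simp [hmap_htmul]

theorem hmap_hmap (f' : F →L[ℂ] E') (f : E →L[ℂ] F) (g' : H →L[ℂ] F') (g : G →L[ℂ] H)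
    (v : HTensor E G) : hmap f' g' (hmap f g v) = hmap (f' ∘L f) (g' ∘L g) v := by
  rw [hmap_comp]; rfl

theorem hmap_one : hmap (1 : E →L[ℂ] E) (1 : F →L[ℂ] F) = 1 :=
  clm_ext_htmul fun x y => by simp [hmap_htmul]

theorem hmap_add_left (f f' : E →L[ℂ] F) (g : G →L[ℂ] H) :
    hmap (f + f') g = hmap f g + hmap f' g :=
  clm_ext_htmul fun x y => by simp [hmap_htmul, htmul_add_left]

theorem hmap_add_right (f : E →L[ℂ] F) (g g' : G →L[ℂ] H) :
    hmap f (g + g') = hmap f g + hmap f g' :=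
  clm_ext_htmul fun x y => by simp [hmap_htmul, htmul_add_right]

theorem hmap_smul_left (c : ℂ) (f : E →L[ℂ] F) (g : G →L[ℂ] H) :
    hmap (c • f) g = c • hmap f g :=
  clm_ext_htmul fun x y => by simp [hmap_htmul, htmul_smul_left]

theorem hmap_smul_right (c : ℂ) (f : E →L[ℂ] F) (g : G →L[ℂ] H) :
    hmap f (c • g) = c • hmap f g :=
  clm_ext_htmul fun x y => by simp [hmap_htmul, htmul_smul_right]

theorem hmap_sum_left {κ : Type*} (s : Finset κ) (f : κ → E →L[ℂ] F) (g : G →L[ℂ] H) :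
    hmap (∑ k ∈ s, f k) g = ∑ k ∈ s, hmap (f k) g := by
  classical
  induction s using Finset.induction_on with
  | empty => simpa using hmap_smul_left (0 : ℂ) (0 : E →L[ℂ] F) g
  | insert a s ha ih => rw [Finset.sum_insert ha, Finset.sum_insert ha, hmap_add_left, ih]

theorem hmap_sum_right {κ : Type*} (s : Finset κ) (f : E →L[ℂ] F) (g : κ → G →L[ℂ] H) :
    hmap f (∑ k ∈ s, g k) = ∑ k ∈ s, hmap f (g k) := by
  classical
  induction s using Finset.induction_on with
  | empty => simpa using hmap_smul_right (0 : ℂ) f (0 : G →L[ℂ] H)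
  | insert a s ha ih => rw [Finset.sum_insert ha, Finset.sum_insert ha, hmap_add_right, ih]

theorem adjoint_hmap [CompleteSpace E] [CompleteSpace F] [CompleteSpace G] [CompleteSpace H]
    (f : E →L[ℂ] F) (g : G →L[ℂ] H) :
    (hmap f g).adjoint = hmap f.adjoint g.adjoint := by
  refine clm_ext_htmul fun x y => ?_
  rw [← sub_eq_zero]
  refine eq_zero_of_inner_htmul fun x' y' => ?_
  rw [inner_sub_right, ContinuousLinearMap.adjoint_inner_right, hmap_htmul, hmap_htmul,
    inner_htmul, inner_htmul, ContinuousLinearMap.adjoint_inner_right,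
    ContinuousLinearMap.adjoint_inner_right, sub_self]

section Ampliation

variable (E F) [CompleteSpace E] [CompleteSpace F]

/-- The ampliation `T ↦ T ⊗ 1`. -/
noncomputable def ampL : (E →L[ℂ] E) →⋆ₐ[ℂ] (HTensor E F →L[ℂ] HTensor E F) where
  toFun T := hmap T 1
  map_one' := hmap_one
  map_mul' S T := by
    exact hmap_comp S T (1 : F →L[ℂ] F) (1 : F →L[ℂ] F)
  map_zero' := by simpa using hmap_smul_left (0 : ℂ) (0 : E →L[ℂ] E) (1 : F →L[ℂ] F)
  map_add' S T := hmap_add_left S T 1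
  commutes' c := by
    rw [Algebra.algebraMap_eq_smul_one, hmap_smul_left, hmap_one, Algebra.algebraMap_eq_smul_one]
  map_star' T := by
    rw [ContinuousLinearMap.star_eq_adjoint, ContinuousLinearMap.star_eq_adjoint, adjoint_hmap,
      ← ContinuousLinearMap.star_eq_adjoint (1 : F →L[ℂ] F), star_one]

/-- The ampliation `T ↦ 1 ⊗ T`. -/
noncomputable def ampR : (F →L[ℂ] F) →⋆ₐ[ℂ] (HTensor E F →L[ℂ] HTensor E F) where
  toFun T := hmap 1 T
  map_one' := hmap_one
  map_mul' S T := by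
    exact hmap_comp (1 : E →L[ℂ] E) (1 : E →L[ℂ] E) S T
  map_zero' := by simpa using hmap_smul_right (0 : ℂ) (1 : E →L[ℂ] E) (0 : F →L[ℂ] F)
  map_add' S T := hmap_add_right 1 S T
  commutes' c := by
    rw [Algebra.algebraMap_eq_smul_one, hmap_smul_right, hmap_one, Algebra.algebraMap_eq_smul_one]
  map_star' T := by
    rw [ContinuousLinearMap.star_eq_adjoint, ContinuousLinearMap.star_eq_adjoint, adjoint_hmap,
      ← ContinuousLinearMap.star_eq_adjoint (1 : E →L[ℂ] E), star_one]

variable {E F}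

theorem ampL_def (T : E →L[ℂ] E) : ampL E F T = hmap T 1 := rfl

theorem ampR_def (T : F →L[ℂ] F) : ampR E F T = hmap 1 T := rfl

theorem ampL_mul_ampR (S : E →L[ℂ] E) (T : F →L[ℂ] F) :
    ampL E F S * ampR E F T = hmap S T := by
  exact (hmap_comp S (1 : E →L[ℂ] E) (1 : F →L[ℂ] F) T).symm

theorem commute_ampL_ampR (S : E →L[ℂ] E) (T : F →L[ℂ] F) :
    Commute (ampL E F S) (ampR E F T) := by
  exact (ampL_mul_ampR S T).trans (hmap_comp (1 : E →L[ℂ] E) S T (1 : F →L[ℂ] F))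

end Ampliation

theorem hmap_comp_tensorRight (f : E →L[ℂ] F) (g : G →L[ℂ] H) (y : G) :
    hmap f g ∘L tensorRight y = tensorRight (g y) ∘L f := by
  ext x; simp [tensorRight_apply, hmap_htmul]

theorem tensorRight_smul (c : ℂ) (y : F) :
    (tensorRight (c • y) : E →L[ℂ] HTensor E F) = c • tensorRight y := by
  ext x; simp [tensorRight_apply, htmul_smul_right]

theorem adjoint_tensorRight_htmul [CompleteSpace E] (y y' : F) (x : E) :
    (tensorRight y : E →L[ℂ] HTensor E F).adjoint (htmul x y') = inner ℂ y y' • x := by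
  refine ext_inner_left ℂ fun v => ?_
  rw [ContinuousLinearMap.adjoint_inner_right, tensorRight_apply, inner_htmul, inner_smul_right,
    mul_comm]

theorem adjoint_tensorRight_comp [CompleteSpace E] (y y' : F) :
    (tensorRight y : E →L[ℂ] HTensor E F).adjoint ∘L tensorRight y' = inner ℂ y y' • 1 := by
  ext x; simp [tensorRight_apply, adjoint_tensorRight_htmul]

/-- Contracting the second factor with the bra `⟨y|` after `g` is contracting it with `⟨g* y|`. -/
theorem adjoint_tensorRight_comp_hmap [CompleteSpace E] [CompleteSpace F] [CompleteSpace G]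
    [CompleteSpace H] (y : H) (f : E →L[ℂ] F) (g : G →L[ℂ] H) :
    (tensorRight y : F →L[ℂ] HTensor F H).adjoint ∘L hmap f g
      = f ∘L (tensorRight (g.adjoint y)).adjoint := by
  refine clm_ext_htmul fun x z => ?_
  simp [hmap_htmul, adjoint_tensorRight_htmul, ContinuousLinearMap.adjoint_inner_left]

end HilbertTensorAlgebra

/-! ### Computational basis components -/

section Kets

variable {E F : Type*} [NormedAddCommGroup E] [InnerProductSpace ℂ E]
  [NormedAddCommGroup F] [InnerProductSpace ℂ F] {n : ℕ}

theorem inner_ket_left (b : Bits n) (v : Register n) : inner ℂ (ket b) v = v b := by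
  simp [ket, EuclideanSpace.inner_single_left]

theorem inner_ket_ket (b c : Bits n) : inner ℂ (ket b) (ket c) = if b = c then (1 : ℂ) else 0 := by
  rw [inner_ket_left]; simp [ket]

theorem sum_smul_ket (v : Register n) : ∑ b, v b • ket b = v := by
  ext c; simp [ket, Pi.single_apply]

/-- The resolution of the identity `∑ |b⟩⟨b| = 1` of the register, ampliated to the tensor product.
-/
theorem sum_tensorRight_ket_comp_adjoint [CompleteSpace E] :
    ∑ b : Bits n, (tensorRight (ket b) : E →L[ℂ] HTensor E (Register n)) ∘L
      (tensorRight (ket b)).adjoint = 1 := by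
  refine clm_ext_htmul fun x y => ?_
  simp only [sum_apply, ContinuousLinearMap.comp_apply,
    adjoint_tensorRight_htmul, tensorRight_apply, htmul_smul_left, one_apply_eq_self]
  simp only [← htmul_smul_right, ← htmul_sum_right, inner_ket_left, sum_smul_ket]

theorem attach_ket₂ (v : HTensor E F) (b b' : Bits n) :
    attach v (ket₂ b b') = hmap (tensorRight (ket b)) (tensorRight (ket b')) v := by
  unfold attach
  rw [Finset.sum_eq_single b, Finset.sum_eq_single b'] <;> simp +contextual [ket₂]

/-- The component of a vector along the computational basis vector `|b b'⟩` of the two outermost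
registers. -/
noncomputable def component [CompleteSpace E] [CompleteSpace F] (b b' : Bits n)
    (v : HTensor (HTensor E (Register n)) (HTensor F (Register n))) : HTensor E F :=
  hmap (tensorRight (ket b) : E →L[ℂ] _).adjoint (tensorRight (ket b') : F →L[ℂ] _).adjoint v

theorem sum_component [CompleteSpace E] [CompleteSpace F]
    (v : HTensor (HTensor E (Register n)) (HTensor F (Register n))) :
    ∑ b : Bits n, ∑ b' : Bits n, attach (component b b' v) (ket₂ b b') = v := by
  have h : hmap (1 : HTensor E (Register n) →L[ℂ] _) (1 : HTensor F (Register n) →L[ℂ] _) v = v := by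
    rw [hmap_one]; rfl
  conv_rhs => rw [← h, ← sum_tensorRight_ket_comp_adjoint, ← sum_tensorRight_ket_comp_adjoint]
  simp only [hmap_sum_left, hmap_sum_right, sum_apply, attach_ket₂, component,
    hmap_hmap]
  rw [Finset.sum_comm]

theorem hmap_attach {E' F' : Type*} [NormedAddCommGroup E'] [InnerProductSpace ℂ E']
    [NormedAddCommGroup F'] [InnerProductSpace ℂ F'] (f : E →L[ℂ] E') (g : F →L[ℂ] F')
    (v : HTensor E F) (χ : TwoRegisters n) :
    attach (hmap f g v) χ = hmap (hmap f 1) (hmap g 1) (attach v χ) := by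
  simp only [attach, map_sum, map_smul, hmap_hmap, hmap_comp_tensorRight,
    one_apply_eq_self]

end Kets

/-! ### One-qubit operators and Pauli matrices -/

section Qubits

variable {n : ℕ}

/-- Only bit strings agreeing with `b` off `j` contribute, and these are parametrised by their
`j`-th bit; identities for `onQubit` thereby reduce to sums over one bit. -/
theorem onQubit_apply (σ : Matrix (Fin 2) (Fin 2) ℂ) (j : Fin n) (v : Register n) (b : Bits n) :
    onQubit σ j v b = ∑ a, σ (b j) a * v (Function.update b j a) := by
  have h : onQubit σ j v b
      = ∑ b' : Bits n, (if ∀ i, i ≠ j → b i = b' i then σ (b j) (b' j) else 0) * v b' := rfl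
  rw [h]
  simp only [ite_mul, zero_mul]
  rw [← Finset.sum_filter]
  refine Finset.sum_nbij' (fun b' => b' j) (fun a => Function.update b j a) (by simp) ?_ ?_
    (by simp) ?_
  · intro a _
    simp +contextual [Function.update_of_ne]
  · intro b' hb'
    ext1 i
    rcases eq_or_ne i j with rfl | hi
    · simp
    · simpa [hi] using (Finset.mem_filter.1 hb').2 i hi
  · intro b' hb'
    have : Function.update b j (b' j) = b' := by
      ext1 i
      rcases eq_or_ne i j with rfl | hi
      · simp
      · simpa [hi] using (Finset.mem_filter.1 hb').2 i hi
    rw [this]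

theorem onQubit_mul (σ τ : Matrix (Fin 2) (Fin 2) ℂ) (j : Fin n) :
    onQubit σ j * onQubit τ j = onQubit (σ * τ) j := by
  ext v b
  rw [mul_apply_eq_comp]
  simp only [onQubit_apply, Function.update_self, Function.update_idem, Matrix.mul_apply,
    Finset.mul_sum, Finset.sum_mul, mul_assoc]
  rw [Finset.sum_comm]

theorem onQubit_one (j : Fin n) : onQubit 1 j = 1 := by
  ext v b
  simp [onQubit_apply, Matrix.one_apply]

theorem onQubit_smul (c : ℂ) (σ : Matrix (Fin 2) (Fin 2) ℂ) (j : Fin n) :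
    onQubit (c • σ) j = c • onQubit σ j := by
  ext v b
  simp [onQubit_apply, mul_assoc, mul_add]

theorem onQubit_neg (σ : Matrix (Fin 2) (Fin 2) ℂ) (j : Fin n) :
    onQubit (-σ) j = -onQubit σ j := by
  ext v b
  simp [onQubit_apply]

theorem commute_onQubit (σ τ : Matrix (Fin 2) (Fin 2) ℂ) {j k : Fin n} (h : j ≠ k) :
    Commute (onQubit σ j) (onQubit τ k) := by
  ext v b
  rw [mul_apply_eq_comp, mul_apply_eq_comp]
  simp only [onQubit_apply, Function.update_of_ne h, Function.update_of_ne h.symm, Finset.mul_sum]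
  rw [Finset.sum_comm]
  refine Finset.sum_congr rfl fun a _ => Finset.sum_congr rfl fun c _ => ?_
  rw [Function.update_comm h]
  ring

theorem star_onQubit (σ : Matrix (Fin 2) (Fin 2) ℂ) (j : Fin n) :
    star (onQubit σ j) = onQubit σ.conjTranspose j := by
  unfold onQubit
  rw [← map_star]
  congr 1
  ext b b'
  have h : (∀ i, i ≠ j → b' i = b i) ↔ ∀ i, i ≠ j → b i = b' i :=
    forall₂_congr fun _ _ => eq_comm
  simp only [Matrix.star_apply, Matrix.of_apply, h, Matrix.conjTranspose_apply]
  split_ifs <;> simp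

theorem σx_mul_σx : σx * σx = 1 := by
  ext i j; fin_cases i <;> fin_cases j <;> simp [σx, Matrix.mul_apply]

theorem σz_mul_σz : σz * σz = 1 := by
  ext i j; fin_cases i <;> fin_cases j <;> simp [σz, Matrix.mul_apply]

theorem σz_mul_σx : σz * σx = -(σx * σz) := by
  ext i j; fin_cases i <;> fin_cases j <;> simp [σx, σz, Matrix.mul_apply]

theorem σy_eq : σy = Complex.I • (σx * σz) := by
  ext i j; fin_cases i <;> fin_cases j <;> simp [σx, σy, σz]

theorem isSelfAdjoint_onQubit_σx (j : Fin n) : IsSelfAdjoint (onQubit σx j) := by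
  rw [IsSelfAdjoint, star_onQubit]
  congr 1
  ext i j; fin_cases i <;> fin_cases j <;> simp [σx]

theorem isSelfAdjoint_onQubit_σz (j : Fin n) : IsSelfAdjoint (onQubit σz j) := by
  rw [IsSelfAdjoint, star_onQubit]
  congr 1
  ext i j; fin_cases i <;> fin_cases j <;> simp [σz]

/-- The eigenvalue `(-1) ^ a` of `σ_z` on `|a⟩`. -/
def bitSign (a : Fin 2) : ℂ := if a = 0 then 1 else -1

theorem onQubit_σz_ket (j : Fin n) (b : Bits n) :
    onQubit σz j (ket b) = bitSign (b j) • ket b := by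
  ext c
  rw [onQubit_apply]
  rcases eq_or_ne c b with rfl | h
  · rcases Fin.exists_fin_two.1 ⟨c j, rfl⟩ with hc | hc
    all_goals
      have h0 := Function.update_eq_self j c
      rw [hc] at h0
      simp [σz, hc, ket, bitSign]
  · have hv : (ket b : Register n) c = 0 := by simp [ket, h]
    have h0 := Function.update_eq_self j c
    rcases Fin.exists_fin_two.1 ⟨c j, rfl⟩ with hc | hc
    all_goals
      rw [hc] at h0
      simp only [Fin.sum_univ_two, σz, hc, bitSign, h0, hv]
      split_ifs <;> simp [hv]

theorem onQubit_σx_ket (j : Fin n) (b : Bits n) :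
    onQubit σx j (ket b) = ket (Function.update b j (b j + 1)) := by
  ext c
  have h1 : onQubit σx j (ket b) c = (ket b : Register n) (Function.update c j (c j + 1)) := by
    rw [onQubit_apply]
    rcases Fin.exists_fin_two.1 ⟨c j, rfl⟩ with hc | hc
    all_goals simp [Fin.sum_univ_two, σx, hc]
  have h2 : ∀ a : Fin 2, a + 1 + 1 = a := by decide
  have h3 : Function.update c j (c j + 1) = b ↔ c = Function.update b j (b j + 1) := by
    constructor
    · rintro rfl; simp [h2]
    · rintro rfl; simp [h2]
  rw [h1]
  simp [ket, h3]

end Qubits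

/-! ### Controlled gates as intertwiners -/

section ControlledGates

variable {A : Type*} [Ring A]

/-- A product of gates carries `a` to `b` if one gate does, and the others commute with both. -/
theorem semiconjBy_list_prod {ι : Type*} {u : ι → A} {a b : A} {j : ι}
    (hj : SemiconjBy (u j) a b) (hne : ∀ i, i ≠ j → Commute (u i) a ∧ Commute (u i) b) :
    ∀ {l : List ι}, l.Nodup → j ∈ l → SemiconjBy (l.map u).prod a b := by
  have key : ∀ {l : List ι}, j ∉ l → ∀ c, (∀ i, i ≠ j → Commute (u i) c) →
      Commute (l.map u).prod c := by
    intro l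
    induction l with
    | nil => intro _ c _; simp
    | cons i l ih =>
      intro hl c hc
      rw [List.mem_cons, not_or] at hl
      rw [List.map_cons, List.prod_cons]
      exact (hc i (Ne.symm hl.1)).mul_left (ih hl.2 c hc)
  intro l
  induction l with
  | nil => simp
  | cons i l ih =>
    intro hnd hjl
    rw [List.nodup_cons] at hnd
    rw [List.map_cons, List.prod_cons]
    rcases List.mem_cons.1 hjl with rfl | h
    · exact hj.mul_left (key hnd.1 a fun i hi => (hne i hi).1)
    · have hij : i ≠ j := by rintro rfl; exact hnd.1 h
      exact SemiconjBy.mul_left (hne i hij).2 (ih hnd.2 h)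

variable [Algebra ℂ A]

/-- For commuting involutions `a` and `b`, the involution that acts as `b` on the `-1` eigenspace of
`a` and trivially on its `+1` eigenspace. -/
noncomputable def controlled (a b : A) : A := (1 / 2 : ℂ) • (1 + a + b - a * b)

theorem Commute.controlled_right {a b c : A} (ha : Commute c a) (hb : Commute c b) :
    Commute c (controlled a b) :=
  ((((Commute.one_right c).add_right ha).add_right hb).sub_right (ha.mul_right hb)).smul_right _

theorem isSelfAdjoint_controlled [StarRing A] [StarModule ℂ A] {a b : A} (h : Commute a b)
    (ha : IsSelfAdjoint a) (hb : IsSelfAdjoint b) : IsSelfAdjoint (controlled a b) := by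
  simp [IsSelfAdjoint, controlled, ha.star_eq, hb.star_eq, h.eq]

/-- Since `a`, `b` and `ab` are commuting involutions, `(1 + a + b - ab)² = 4`, which the factor
`1/2` normalises. -/
theorem controlled_mul_self {a b : A} (h : Commute a b) (ha : a * a = 1) (hb : b * b = 1) :
    controlled a b * controlled a b = 1 := by
  have h1 : a * b * a = b := by rw [mul_assoc, ← h.eq, ← mul_assoc, ha, one_mul]
  have h2 : a * b * b = a := by rw [mul_assoc, hb, mul_one]
  have h3 : a * (a * b) = b := by rw [← mul_assoc, ha, one_mul]
  have h4 : b * (a * b) = a := by rw [h.eq, ← mul_assoc, hb, one_mul]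
  have h5 : a * b * (a * b) = 1 := by rw [← mul_assoc, h1, hb]
  have h6 : (1 + a + b - a * b) * (1 + a + b - a * b) = (4 : ℂ) • 1 := by
    have : (1 + a + b - a * b) * (1 + a + b - a * b)
        = 1 + a * a + b * b + a * b * (a * b) + 2 * a + 2 * b + a * b + b * a - 2 * (a * b)
          - a * (a * b) - b * (a * b) - a * b * a - a * b * b := by noncomm_ring
    rw [this, ha, hb, h1, h2, h3, h4, h5, ← h.eq]
    rw [Algebra.smul_def, map_ofNat]
    noncomm_ring
  rw [controlled, smul_mul_smul_comm, h6, smul_smul]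
  norm_num

/-- Kicking a conjugate operator `t` of the target back to the control. -/
theorem semiconjBy_controlled_kickback {a s t : A} (has : Commute a s) (hat : Commute a t)
    (ha : a * a = 1) (hst : s * t = -(t * s)) : SemiconjBy (controlled a s) (a * t) t := by
  have h1 : a * (a * t) = t := by rw [← mul_assoc, ha, one_mul]
  have h2 : s * (a * t) = -(t * a * s) := by
    rw [← mul_assoc, ← has.eq, mul_assoc, hst, mul_neg, ← mul_assoc, hat.eq]
  have h3 : a * s * (a * t) = -(t * s) := by
    rw [mul_assoc, h2, mul_neg, ← hat.eq, mul_assoc, ← mul_assoc, ha, one_mul]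
  rw [SemiconjBy, controlled, smul_mul_assoc, mul_smul_comm, sub_mul, add_mul, add_mul, one_mul,
    h1, h2, h3, hat.eq]
  congr 1
  noncomm_ring

/-- Propagating an operator `x` that flips the control `z` to the target. -/
theorem semiconjBy_controlled_propagate {z s x : A} (hzs : Commute z s) (hxs : Commute x s)
    (hs : s * s = 1) (hzx : z * x = -(x * z)) :
    SemiconjBy (controlled z s) x (x * s) := by
  have h1 : z * s * x = -(x * z * s) := by
    rw [mul_assoc, ← hxs.eq, ← mul_assoc, hzx, neg_mul]
  have h2 : x * s * z = x * z * s := by rw [mul_assoc, ← hzs.eq, mul_assoc]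
  have h3 : x * s * s = x := by rw [mul_assoc, hs, mul_one]
  have h4 : x * s * (z * s) = x * z := by rw [← mul_assoc, h2, mul_assoc, hs, mul_one]
  rw [SemiconjBy, controlled, smul_mul_assoc, mul_smul_comm, sub_mul, add_mul, add_mul, one_mul,
    hzx, h1, mul_sub, mul_add, mul_add, mul_one, h2, h3, h4, ← hxs.eq]
  congr 1
  abel

end ControlledGates

/-! ### Pauli relations on a corner, and the chirality -/

section PauliSystems

variable {A : Type*} [Ring A] [StarRing A] {n : ℕ}

/-- A family of operators supported on the range of the projection `p` that satisfy there the
algebraic relations of the Pauli operators `σ_z`, `σ_x`, `σ_y` (with indices `0`, `1`, `2`) of `n`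
qubits, apart from `σ_x σ_y σ_z = i`. -/
structure IsPauliSystem (p : A) (a : Fin n → Fin 3 → A) : Prop where
  isStarProjection : IsStarProjection p
  isSelfAdjoint : ∀ i s, IsSelfAdjoint (a i s)
  mul_proj : ∀ i s, a i s * p = a i s
  mul_self : ∀ i s, a i s * a i s = p
  anticomm : ∀ i s t, s ≠ t → a i s * a i t = -(a i t * a i s)
  comm : ∀ i k s t, i ≠ k → Commute (a i s) (a k t)

/-- The extension of an involution of the range of `p` by the identity. -/
def extendOne (p t : A) : A := t + (1 - p)

section ExtendOne

variable {p t r : A}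

theorem proj_mul_of_mul_proj (hp : IsStarProjection p) (ht : IsSelfAdjoint t) (h : t * p = t) :
    p * t = t := by
  simpa [hp.isSelfAdjoint.star_eq, ht.star_eq] using congrArg star h

theorem isSelfAdjoint_extendOne (hp : IsStarProjection p) (ht : IsSelfAdjoint t) :
    IsSelfAdjoint (extendOne p t) := by
  simp [IsSelfAdjoint, extendOne, hp.isSelfAdjoint.star_eq, ht.star_eq]

omit [StarRing A] in
theorem extendOne_mul_of_proj_mul (h : p * r = r) : extendOne p t * r = t * r := by
  simp [extendOne, add_mul, sub_mul, h]

omit [StarRing A] in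
theorem mul_extendOne_of_mul_proj (h : r * p = r) : r * extendOne p t = r * t := by
  simp [extendOne, mul_add, mul_sub, h]

theorem extendOne_mul_self (hp : IsStarProjection p) (ht : IsSelfAdjoint t) (h : t * p = t)
    (hs : t * t = p) : extendOne p t * extendOne p t = 1 := by
  have hpp : p * p = p := hp.isIdempotentElem
  have hpt := proj_mul_of_mul_proj hp ht h
  have : extendOne p t * extendOne p t = t * t + t - t * p + t - p * t + 1 - p - p + p * p := by
    unfold extendOne; noncomm_ring
  rw [this, hs, h, hpt, hpp]
  abel

omit [StarRing A] in
theorem commute_extendOne (h : Commute r t) (hp : Commute r p) : Commute r (extendOne p t) :=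
  h.add_right ((Commute.one_right r).sub_right hp)

theorem commute_extendOne_extendOne (hp : IsStarProjection p) (ht : IsSelfAdjoint t)
    (h : t * p = t) (hr : IsSelfAdjoint r) (h' : r * p = r) (hc : Commute t r) :
    Commute (extendOne p t) (extendOne p r) := by
  have h1 : Commute t p := h.trans (proj_mul_of_mul_proj hp ht h).symm
  have h2 : Commute r p := h'.trans (proj_mul_of_mul_proj hp hr h').symm
  refine commute_extendOne (Commute.symm (commute_extendOne hc.symm h2)) ?_
  exact (commute_extendOne h1.symm (Commute.refl p)).symm

end ExtendOne

namespace IsPauliSystem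

variable {p : A} {a : Fin n → Fin 3 → A} (h : IsPauliSystem p a)

include h

theorem proj_mul (i : Fin n) (s : Fin 3) : p * a i s = a i s :=
  proj_mul_of_mul_proj h.isStarProjection (h.isSelfAdjoint i s) (h.mul_proj i s)

theorem map {B F : Type*} [Ring B] [StarRing B] [FunLike F A B] [RingHomClass F A B]
    [StarHomClass F A B] (f : F) : IsPauliSystem (f p) (fun i s => f (a i s)) where
  isStarProjection := ⟨h.isStarProjection.isIdempotentElem.map f,
    by rw [IsSelfAdjoint, ← map_star, h.isStarProjection.isSelfAdjoint.star_eq]⟩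
  isSelfAdjoint i s := by rw [IsSelfAdjoint, ← map_star, (h.isSelfAdjoint i s).star_eq]
  mul_proj i s := by rw [← map_mul, h.mul_proj]
  mul_self i s := by rw [← map_mul, h.mul_self]
  anticomm i s t hst := by rw [← map_mul, h.anticomm i s t hst, map_neg, map_mul]
  comm i k s t hik := by rw [Commute, SemiconjBy, ← map_mul, (h.comm i k s t hik).eq, map_mul]

omit h
variable [Algebra ℂ A]

/-- The central involution `-i σ_x σ_y σ_z` that distinguishes the Pauli operators from their complex
conjugates. -/
noncomputable def chirality (a : Fin n → Fin 3 → A) (i : Fin n) : A :=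
  (-Complex.I) • (a i 1 * a i 2 * a i 0)

include h

theorem chirality_mul_proj (i : Fin n) : chirality a i * p = chirality a i := by
  rw [chirality, smul_mul_assoc, mul_assoc, h.mul_proj]

/-- Reversing a product of three anticommuting factors takes three transpositions; the resulting
sign cancels that of the conjugate of `-i`. -/
theorem isSelfAdjoint_chirality [StarModule ℂ A] (i : Fin n) :
    IsSelfAdjoint (chirality a i) := by
  have e : a i 0 * (a i 2 * a i 1) = -(a i 1 * a i 2 * a i 0) := by
    rw [← mul_assoc, h.anticomm i 0 2 (by decide), neg_mul, mul_assoc,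
      h.anticomm i 0 1 (by decide), mul_neg, neg_neg, ← mul_assoc, h.anticomm i 2 1 (by decide),
      neg_mul]
  rw [IsSelfAdjoint, chirality, star_smul, star_mul, star_mul, (h.isSelfAdjoint i 0).star_eq,
    (h.isSelfAdjoint i 1).star_eq, (h.isSelfAdjoint i 2).star_eq, e]
  simp

/-- For `k = i`, moving one of the three factors through the product passes two anticommuting ones,
and the signs cancel. -/
theorem commute_chirality (i k : Fin n) (s : Fin 3) : Commute (chirality a i) (a k s) := by
  refine Commute.smul_left ?_ _
  rcases ne_or_eq i k with hik | rfl
  · exact ((h.comm i k 1 s hik).mul_left (h.comm i k 2 s hik)).mul_left (h.comm i k 0 s hik)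
  have e21 := h.anticomm i 2 1 (by decide)
  have e01 := h.anticomm i 0 1 (by decide)
  have e02 := h.anticomm i 0 2 (by decide)
  rw [Commute, SemiconjBy]
  fin_cases s
  · change a i 1 * a i 2 * a i 0 * a i 0 = a i 0 * (a i 1 * a i 2 * a i 0)
    rw [← mul_assoc, ← mul_assoc, e01, neg_mul, mul_assoc (a i 1) (a i 0), e02, mul_neg, neg_neg,
      ← mul_assoc]
  · change a i 1 * a i 2 * a i 0 * a i 1 = a i 1 * (a i 1 * a i 2 * a i 0)
    rw [mul_assoc, mul_assoc, ← mul_assoc (a i 2), mul_assoc (a i 2), e01, mul_neg, ← mul_assoc, e21,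
      neg_mul, neg_neg]
  · change a i 1 * a i 2 * a i 0 * a i 2 = a i 2 * (a i 1 * a i 2 * a i 0)
    rw [mul_assoc, e02, mul_neg, ← mul_assoc, ← mul_assoc, ← mul_assoc, e21, neg_mul, neg_mul]

theorem commute_chirality_chirality (i k : Fin n) :
    Commute (chirality a i) (chirality a k) :=
  (((h.commute_chirality i k 1).mul_right (h.commute_chirality i k 2)).mul_right
    (h.commute_chirality i k 0)).smul_right _

theorem chirality_mul_self (i : Fin n) : chirality a i * chirality a i = p := by
  have e01 := h.anticomm i 0 1 (by decide)
  have e02 := h.anticomm i 0 2 (by decide)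
  have e21 := h.anticomm i 2 1 (by decide)
  have e : a i 1 * a i 2 * a i 0 * (a i 1 * a i 2 * a i 0) = -p := by
    calc a i 1 * a i 2 * a i 0 * (a i 1 * a i 2 * a i 0)
        = a i 1 * a i 2 * (a i 0 * a i 1) * a i 2 * a i 0 := by noncomm_ring
      _ = -(a i 1 * a i 2 * a i 1 * (a i 0 * a i 2) * a i 0) := by rw [e01]; noncomm_ring
      _ = a i 1 * (a i 2 * a i 1) * a i 2 * (a i 0 * a i 0) := by rw [e02]; noncomm_ring
      _ = -((a i 1 * a i 1) * (a i 2 * a i 2) * (a i 0 * a i 0)) := by rw [e21]; noncomm_ring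
      _ = -p := by
        rw [h.mul_self, h.mul_self, h.mul_self, h.isStarProjection.isIdempotentElem.eq,
          h.isStarProjection.isIdempotentElem.eq]
  rw [chirality, smul_mul_smul_comm, e]
  simp

/-- This is `σ_y = i σ_x σ_z` corrected by the chirality, so a unitary that handles `σ_z`, `σ_x` and
the chirality handles `σ_y` as well. -/
theorem chirality_mul (i : Fin n) : a i 2 = Complex.I • (chirality a i * a i 1 * a i 0) := by
  have e01 := h.anticomm i 0 1 (by decide)
  have e21 := h.anticomm i 2 1 (by decide)
  have e : a i 1 * a i 2 * a i 0 * a i 1 * a i 0 = a i 2 := by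
    calc a i 1 * a i 2 * a i 0 * a i 1 * a i 0
        = a i 1 * a i 2 * (a i 0 * a i 1) * a i 0 := by noncomm_ring
      _ = -(a i 1 * (a i 2 * a i 1) * (a i 0 * a i 0)) := by rw [e01]; noncomm_ring
      _ = (a i 1 * a i 1) * a i 2 * (a i 0 * a i 0) := by rw [e21]; noncomm_ring
      _ = a i 2 := by rw [h.mul_self, h.mul_self, mul_assoc, h.mul_proj, h.proj_mul]
  rw [chirality, smul_mul_assoc, smul_mul_assoc, e, smul_smul]
  simp

end IsPauliSystem

end PauliSystems

/-! ### The swap circuit in a star algebra -/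

section AbstractSwap

variable {A : Type*} [Ring A] [StarRing A] {n : ℕ}

/-- Operators `s i`, `t i` that behave as `σ_x`, `σ_z` on the `i`-th of `n` qubits. -/
structure IsQubitSystem (s t : Fin n → A) : Prop where
  isSelfAdjoint_left : ∀ i, IsSelfAdjoint (s i)
  isSelfAdjoint_right : ∀ i, IsSelfAdjoint (t i)
  left_mul_self : ∀ i, s i * s i = 1
  right_mul_self : ∀ i, t i * t i = 1
  anticomm : ∀ i, t i * s i = -(s i * t i)
  comm_left : ∀ i k, Commute (s i) (s k)
  comm_right : ∀ i k, Commute (t i) (t k)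
  comm : ∀ i k, i ≠ k → Commute (s i) (t k)

variable [Algebra ℂ A] [StarModule ℂ A]

/-- For each `i` the circuit copies the chirality into the qubit `(s', t')`, then copies the
`z`-value into `(s, t)`, and finally uses a gate controlled by `(s, t)` to erase that value from the
system. The last two gates swap the system with a qubit in `|0⟩`. The state `|0⟩` enters only
through the factors `t` and `t'` on the left, which fix it. As the Pauli operators are involutions
only under `p`, they are extended by the identity to obtain unitary gates. -/
theorem exists_unitary_swap {p : A} {a : Fin n → Fin 3 → A} (h : IsPauliSystem p a)
    {s t s' t' : Fin n → A} (hq : IsQubitSystem s t) (hq' : IsQubitSystem s' t')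
    (hs : ∀ i k r, Commute (a i r) (s k)) (ht : ∀ i k r, Commute (a i r) (t k))
    (hs' : ∀ i k r, Commute (a i r) (s' k)) (ht' : ∀ i k r, Commute (a i r) (t' k))
    (hps : ∀ k, Commute p (s k)) (hpt : ∀ k, Commute p (t k))
    (hps' : ∀ k, Commute p (s' k)) (hpt' : ∀ k, Commute p (t' k))
    (hss' : ∀ i k, Commute (s i) (s' k)) (hst' : ∀ i k, Commute (s i) (t' k))
    (hts' : ∀ i k, Commute (t i) (s' k)) (htt' : ∀ i k, Commute (t i) (t' k)) :
    ∃ U ∈ unitary A, ∀ j,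
      U * (a j 0 * t j) = t j * U * p ∧
      U * a j 1 = s j * U * p ∧
      U * (IsPauliSystem.chirality a j * t' j) = t' j * U * p ∧
      U * (a j 2 * t j * t' j) = t' j * (Complex.I • (s j * t j)) * U * p := by
  set c : Fin n → A := IsPauliSystem.chirality a with hc
  have hp := h.isStarProjection
  have hpa : ∀ i r, Commute p (a i r) := fun i r => (h.proj_mul i r).trans (h.mul_proj i r).symm
  have hpc : ∀ i, Commute p (c i) := fun i =>
    (proj_mul_of_mul_proj hp (h.isSelfAdjoint_chirality i) (h.chirality_mul_proj i)).trans
      (h.chirality_mul_proj i).symm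
  have hcb : ∀ {b : A}, (∀ i r, Commute (a i r) b) → ∀ i, Commute (c i) b := fun hb i =>
    (((hb i 1).mul_left (hb i 2)).mul_left (hb i 0)).smul_left _
  -- extended involutions
  let z := fun i => extendOne p (a i 0)
  let x := fun i => extendOne p (a i 1)
  let d := fun i => extendOne p (c i)
  have ext_comm : ∀ {r b : A}, Commute r b → Commute p b → Commute (extendOne p r) b :=
    fun h1 h2 => (commute_extendOne h1.symm h2.symm).symm
  have hzz : ∀ i, z i * z i = 1 := fun i =>
    extendOne_mul_self hp (h.isSelfAdjoint i 0) (h.mul_proj i 0) (h.mul_self i 0)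
  have hxx : ∀ i, x i * x i = 1 := fun i =>
    extendOne_mul_self hp (h.isSelfAdjoint i 1) (h.mul_proj i 1) (h.mul_self i 1)
  have hdd : ∀ i, d i * d i = 1 := fun i =>
    extendOne_mul_self hp (h.isSelfAdjoint_chirality i) (h.chirality_mul_proj i)
      (h.chirality_mul_self i)
  have hxp : ∀ i, x i * p = a i 1 := fun i => by
    rw [extendOne_mul_of_proj_mul hp.isIdempotentElem, h.mul_proj]
  have hzp : ∀ i, z i * p = a i 0 := fun i => by
    rw [extendOne_mul_of_proj_mul hp.isIdempotentElem, h.mul_proj]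
  have hdp : ∀ i, d i * p = c i := fun i => by
    rw [extendOne_mul_of_proj_mul hp.isIdempotentElem, h.chirality_mul_proj]
  -- gates
  let u₁ := fun i => controlled (x i) (t i)
  let u₂ := fun i => controlled (z i) (s i)
  let u₃ := fun i => controlled (d i) (s' i)
  -- The rightmost gate acts first; gates with different indices need only commute with each other's
  -- operators, so the order of the indices is immaterial.
  let u := fun i => u₁ i * u₂ i * u₃ i
  have u_comm : ∀ {i} {b : A}, Commute (x i) b → Commute (t i) b → Commute (z i) b →
      Commute (s i) b → Commute (d i) b → Commute (s' i) b → Commute (u i) b :=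
    fun h1 h2 h3 h4 h5 h6 =>
      (((Commute.controlled_right h1.symm h2.symm).mul_right
        (Commute.controlled_right h3.symm h4.symm)).mul_right
          (Commute.controlled_right h5.symm h6.symm)).symm
  have hxt : ∀ i k, Commute (x i) (t k) := fun i k => ext_comm (ht i k 1) (hpt k)
  have hzt : ∀ i k, Commute (z i) (t k) := fun i k => ext_comm (ht i k 0) (hpt k)
  have hdt : ∀ i k, Commute (d i) (t k) := fun i k => ext_comm (hcb (ht · k ·) i) (hpt k)
  have hxs : ∀ i k, Commute (x i) (s k) := fun i k => ext_comm (hs i k 1) (hps k)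
  have hzs : ∀ i k, Commute (z i) (s k) := fun i k => ext_comm (hs i k 0) (hps k)
  have hds : ∀ i k, Commute (d i) (s k) := fun i k => ext_comm (hcb (hs · k ·) i) (hps k)
  have hxt' : ∀ i k, Commute (x i) (t' k) := fun i k => ext_comm (ht' i k 1) (hpt' k)
  have hzt' : ∀ i k, Commute (z i) (t' k) := fun i k => ext_comm (ht' i k 0) (hpt' k)
  have hdt' : ∀ i k, Commute (d i) (t' k) := fun i k => ext_comm (hcb (ht' · k ·) i) (hpt' k)
  have hds' : ∀ i k, Commute (d i) (s' k) := fun i k => ext_comm (hcb (hs' · k ·) i) (hps' k)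
  have hzs' : ∀ i k, Commute (z i) (s' k) := fun i k => ext_comm (hs' i k 0) (hps' k)
  have hext : ∀ {r b : A}, Commute r b → IsSelfAdjoint r → r * p = r → IsSelfAdjoint b →
      b * p = b → Commute (extendOne p r) (extendOne p b) := fun h1 h2 h3 h4 h5 =>
    commute_extendOne_extendOne hp h2 h3 h4 h5 h1
  have hca := h.commute_chirality
  have hdz : ∀ i k, Commute (d i) (z k) := fun i k => hext (hca i k 0)
    (h.isSelfAdjoint_chirality i) (h.chirality_mul_proj i) (h.isSelfAdjoint k 0) (h.mul_proj k 0)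
  have hdd' : ∀ i k, Commute (d i) (d k) := fun i k => hext (h.commute_chirality_chirality i k)
    (h.isSelfAdjoint_chirality i) (h.chirality_mul_proj i) (h.isSelfAdjoint_chirality k)
    (h.chirality_mul_proj k)
  have hdx : ∀ i k, Commute (d i) (x k) := fun i k => hext (hca i k 1)
    (h.isSelfAdjoint_chirality i) (h.chirality_mul_proj i) (h.isSelfAdjoint k 1) (h.mul_proj k 1)
  have hzz' : ∀ i k, i ≠ k → Commute (z i) (z k) := fun i k hik => hext (h.comm i k 0 0 hik)
    (h.isSelfAdjoint i 0) (h.mul_proj i 0) (h.isSelfAdjoint k 0) (h.mul_proj k 0)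
  have hxz : ∀ i k, i ≠ k → Commute (x i) (z k) := fun i k hik => hext (h.comm i k 1 0 hik)
    (h.isSelfAdjoint i 1) (h.mul_proj i 1) (h.isSelfAdjoint k 0) (h.mul_proj k 0)
  have hpp : Commute p p := Commute.refl p
  have u_p : ∀ i, Commute (u i) p := fun i =>
    u_comm (ext_comm (hpa i 1).symm hpp) (hpt i).symm (ext_comm (hpa i 0).symm hpp) (hps i).symm
      (ext_comm (hpc i).symm hpp) (hps' i).symm
  have u_ax : ∀ i k, i ≠ k → Commute (u i) (a k 1) := fun i k hik =>
    u_comm (ext_comm (h.comm i k 1 1 hik) (hpa k 1)) (ht k i 1).symm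
      (ext_comm (h.comm i k 0 1 hik) (hpa k 1)) (hs k i 1).symm
      (ext_comm (hca i k 1) (hpa k 1)) (hs' k i 1).symm
  have u_t : ∀ i k, i ≠ k → Commute (u i) (t k) := fun i k hik =>
    u_comm (hxt i k) (hq.comm_right i k) (hzt i k) (hq.comm i k hik) (hdt i k) (hts' k i).symm
  have u_s : ∀ i k, i ≠ k → Commute (u i) (s k) := fun i k hik =>
    u_comm (hxs i k) (hq.comm k i hik.symm).symm (hzs i k) (hq.comm_left i k) (hds i k)
      (hss' k i).symm
  have u_t' : ∀ i k, i ≠ k → Commute (u i) (t' k) := fun i k hik =>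
    u_comm (hxt' i k) (htt' i k) (hzt' i k) (hst' i k) (hdt' i k) (hq'.comm i k hik)
  have u_z : ∀ i k, i ≠ k → Commute (u i) (z k) := fun i k hik =>
    u_comm (hxz i k hik) (hzt k i).symm (hzz' i k hik) (hzs k i).symm (hdz i k) (hzs' k i).symm
  have u_d : ∀ i k, i ≠ k → Commute (u i) (d k) := fun i k hik =>
    u_comm (hdx k i).symm (hdt k i).symm (hdz k i).symm (hds k i).symm (hdd' i k) (hds' k i).symm
  have sz : ∀ j, SemiconjBy (u j) (z j * t j) (t j) := fun j => by
    have h3 : Commute (u₃ j) (z j * t j) := ((Commute.controlled_right (hdz j j).symm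
      (hzs' j j)).mul_left (Commute.controlled_right (hdt j j).symm (hts' j j))).symm
    have h2 : SemiconjBy (u₂ j) (z j * t j) (t j) := semiconjBy_controlled_kickback (hzs j j)
      (hzt j j) (hzz j) (by rw [hq.anticomm j, neg_neg])
    have h1 : Commute (u₁ j) (t j) :=
      (Commute.controlled_right (hxt j j).symm (Commute.refl _)).symm
    exact (SemiconjBy.mul_left h1 h2).mul_left h3
  have sd : ∀ j, SemiconjBy (u j) (d j * t' j) (t' j) := fun j => by
    have h3 : SemiconjBy (u₃ j) (d j * t' j) (t' j) := semiconjBy_controlled_kickback (hds' j j)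
      (hdt' j j) (hdd j) (by rw [hq'.anticomm j, neg_neg])
    have h2 : Commute (u₂ j) (t' j) :=
      (Commute.controlled_right (hzt' j j).symm (hst' j j).symm).symm
    have h1 : Commute (u₁ j) (t' j) :=
      (Commute.controlled_right (hxt' j j).symm (htt' j j).symm).symm
    exact (SemiconjBy.mul_left h1 h2).mul_left h3
  -- Along the circuit `σ_x` is first propagated to `σ_x ⊗ s` and then kicked back to `s`.
  have sx : ∀ j, SemiconjBy (u j) (a j 1) (s j * p) := fun j => by
    have h3 : Commute (u₃ j) (a j 1) := (Commute.controlled_right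
      (ext_comm (hca j j 1) (hpa j 1)).symm (hs' j j 1)).symm
    have h2 : SemiconjBy (u₂ j) (a j 1) (a j 1 * s j) := by
      refine semiconjBy_controlled_propagate (hzs j j) (hs j j 1) (hq.left_mul_self j) ?_
      rw [extendOne_mul_of_proj_mul (h.proj_mul j 1), mul_extendOne_of_mul_proj (h.mul_proj j 1),
        h.anticomm j 0 1 (by decide)]
    have h1 : SemiconjBy (u₁ j) (a j 1 * s j) (s j * p) := by
      have k1 : SemiconjBy (u₁ j) (x j * s j) (s j) := semiconjBy_controlled_kickback (hxt j j)
        (hxs j j) (hxx j) (hq.anticomm j)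
      have k2 : Commute (u₁ j) p := (Commute.controlled_right
        (ext_comm (hpa j 1).symm hpp).symm (hpt j)).symm
      have k3 : a j 1 * s j = x j * s j * p := by
        rw [mul_assoc, ← (hps j).eq, ← mul_assoc, hxp]
      rw [k3]
      exact k1.mul_right k2
    exact (h1.mul_left h2).mul_left h3
  have u_unitary : ∀ i, u i ∈ unitary A := fun i => by
    have hsa : ∀ {g : A}, IsSelfAdjoint g → g * g = 1 → g ∈ unitary A := fun h1 h2 => by
      rw [Unitary.mem_iff, h1.star_eq]; exact ⟨h2, h2⟩
    refine mul_mem (mul_mem (hsa ?_ ?_) (hsa ?_ ?_)) (hsa ?_ ?_)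
    · exact isSelfAdjoint_controlled (hxt i i) (isSelfAdjoint_extendOne hp (h.isSelfAdjoint i 1))
        (hq.isSelfAdjoint_right i)
    · exact controlled_mul_self (hxt i i) (hxx i) (hq.right_mul_self i)
    · exact isSelfAdjoint_controlled (hzs i i) (isSelfAdjoint_extendOne hp (h.isSelfAdjoint i 0))
        (hq.isSelfAdjoint_left i)
    · exact controlled_mul_self (hzs i i) (hzz i) (hq.left_mul_self i)
    · exact isSelfAdjoint_controlled (hds' i i) (isSelfAdjoint_extendOne hp
        (h.isSelfAdjoint_chirality i)) (hq'.isSelfAdjoint_left i)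
    · exact controlled_mul_self (hds' i i) (hdd i) (hq'.left_mul_self i)
  have hnd := List.nodup_finRange n
  have hmem := List.mem_finRange (n := n)
  set U := ((List.finRange n).map u).prod with hU
  have Uz : ∀ j, U * (z j * t j) = t j * U := fun j =>
    semiconjBy_list_prod (sz j) (fun i hi => ⟨(u_z i j hi).mul_right (u_t i j hi), u_t i j hi⟩)
      hnd (hmem j)
  have Ud : ∀ j, U * (d j * t' j) = t' j * U := fun j =>
    semiconjBy_list_prod (sd j) (fun i hi => ⟨(u_d i j hi).mul_right (u_t' i j hi), u_t' i j hi⟩)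
      hnd (hmem j)
  have Ux : ∀ j, U * a j 1 = s j * p * U := fun j =>
    semiconjBy_list_prod (sx j) (fun i hi => ⟨u_ax i j hi, (u_s i j hi).mul_right (u_p i)⟩)
      hnd (hmem j)
  have Up : U * p = p * U := by
    -- `semiconjBy_list_prod` needs some index in the list; for `n = 0` the product is empty.
    rcases n with _ | n
    · simp [hU]
    · exact semiconjBy_list_prod (j := 0) (u_p 0) (fun i _ => ⟨u_p i, u_p i⟩) hnd (hmem 0)
  have Uz' : ∀ j, U * (a j 0 * t j) = t j * U * p := fun j => by
    rw [← Uz, ← hzp, mul_assoc (z j), (hpt j).eq, ← mul_assoc (z j), mul_assoc U]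
  have Ux' : ∀ j, U * a j 1 = s j * U * p := fun j => by
    rw [Ux, mul_assoc, mul_assoc, Up]
  have Ud' : ∀ j, U * (c j * t' j) = t' j * U * p := fun j => by
    rw [← Ud, ← hdp, mul_assoc (d j), (hpt' j).eq, ← mul_assoc (d j), mul_assoc U]
  refine ⟨U, list_prod_mem fun g hg => ?_, fun j => ⟨Uz' j, Ux' j, Ud' j, ?_⟩⟩
  · obtain ⟨i, _, rfl⟩ := List.mem_map.1 hg
    exact u_unitary i
  -- After writing `σ_y` through the chirality, the product is regrouped into `c t'`, `σ_x` and `σ_z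
  -- t`, which `Ud'`, `Ux'` and `Uz'` move across `U`.
  · have e1 : c j * a j 1 * a j 0 * t j * t' j = c j * t' j * (a j 1 * (a j 0 * t j)) := by
      have : Commute (t' j) (a j 1 * (a j 0 * t j)) :=
        (ht' j j 1).symm.mul_right ((ht' j j 0).symm.mul_right (htt' j j).symm)
      rw [mul_assoc (c j) (t' j), this.eq]
      simp only [mul_assoc]
    rw [h.chirality_mul j, smul_mul_assoc, smul_mul_assoc, mul_smul_comm, ← hc, e1, ← mul_assoc U,
      Ud', mul_assoc (t' j * U), ← mul_assoc p, h.proj_mul, mul_assoc (t' j), ← mul_assoc U, Ux',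
      mul_assoc (s j * U), ← mul_assoc p, h.proj_mul, mul_assoc (s j), Uz', mul_smul_comm,
      smul_mul_assoc, smul_mul_assoc]
    simp only [mul_assoc]

end AbstractSwap

theorem IsQubitSystem.map {A B F : Type*} [Ring A] [StarRing A] {n : ℕ} {s t : Fin n → A}
    (h : IsQubitSystem s t) [Ring B] [StarRing B] [FunLike F A B] [RingHomClass F A B]
    [StarHomClass F A B] (f : F) : IsQubitSystem (fun i => f (s i)) (fun i => f (t i)) where
  isSelfAdjoint_left i := by rw [IsSelfAdjoint, ← map_star, (h.isSelfAdjoint_left i).star_eq]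
  isSelfAdjoint_right i := by rw [IsSelfAdjoint, ← map_star, (h.isSelfAdjoint_right i).star_eq]
  left_mul_self i := by rw [← map_mul, h.left_mul_self, map_one]
  right_mul_self i := by rw [← map_mul, h.right_mul_self, map_one]
  anticomm i := by rw [← map_mul, h.anticomm, map_neg, map_mul]
  comm_left i k := by rw [Commute, SemiconjBy, ← map_mul, (h.comm_left i k).eq, map_mul]
  comm_right i k := by rw [Commute, SemiconjBy, ← map_mul, (h.comm_right i k).eq, map_mul]
  comm i k hik := by rw [Commute, SemiconjBy, ← map_mul, (h.comm i k hik).eq, map_mul]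

theorem isQubitSystem_onQubit (n : ℕ) :
    IsQubitSystem (onQubit σx : Fin n → Register n →L[ℂ] Register n) (onQubit σz) where
  isSelfAdjoint_left := isSelfAdjoint_onQubit_σx
  isSelfAdjoint_right := isSelfAdjoint_onQubit_σz
  left_mul_self i := by rw [onQubit_mul, σx_mul_σx, onQubit_one]
  right_mul_self i := by rw [onQubit_mul, σz_mul_σz, onQubit_one]
  anticomm i := by rw [onQubit_mul, σz_mul_σx, onQubit_neg, onQubit_mul]
  comm_left i k := by
    rcases eq_or_ne i k with rfl | h
    exacts [Commute.refl _, commute_onQubit _ _ h]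
  comm_right i k := by
    rcases eq_or_ne i k with rfl | h
    exacts [Commute.refl _, commute_onQubit _ _ h]
  comm i k h := commute_onQubit _ _ h

/-! ### The local unitary of one party -/

section LocalUnitary

variable {H : Type*} [NormedAddCommGroup H] [InnerProductSpace ℂ H] {n : ℕ}

/-- The embedding `x ↦ x ⊗ |0⟩ ⊗ |0⟩`. -/
noncomputable def zeros (H : Type*) [NormedAddCommGroup H] [InnerProductSpace ℂ H] (n : ℕ) :
    H →L[ℂ] Extended H n :=
  tensorRight (ket 0) ∘L tensorRight (ket 0)

theorem zeros_apply (x : H) : zeros H n x = htmul (htmul x (ket 0)) (ket 0) := rfl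

theorem withZeros_eq {E F : Type*} [NormedAddCommGroup E] [InnerProductSpace ℂ E]
    [NormedAddCommGroup F] [InnerProductSpace ℂ F] (v : HTensor E F) :
    withZeros n v = hmap (zeros E n) (zeros F n) v := by
  rw [withZeros, attach_ket₂, attach_ket₂, hmap_hmap]; rfl

theorem onQubit_σz_ket_zero (j : Fin n) : onQubit σz j (ket 0) = ket 0 := by
  rw [onQubit_σz_ket]; simp [bitSign]

theorem adjoint_zeros_comp [CompleteSpace H] : (zeros H n).adjoint ∘L zeros H n = 1 := by
  ext x
  refine ext_inner_left ℂ fun y => ?_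
  rw [ContinuousLinearMap.comp_apply, ContinuousLinearMap.adjoint_inner_right, zeros_apply,
    zeros_apply, inner_htmul, inner_htmul, inner_ket_ket]
  simp

/-- The operator `1 ⊗ M` on a party's space, with `M` acting on the inner register. -/
noncomputable abbrev onInner (M : Register n →L[ℂ] Register n) : Extended H n →L[ℂ] Extended H n :=
  hmap (hmap 1 M) 1

/-- The operator `1 ⊗ M` on a party's space, with `M` acting on the outer register. -/
noncomputable abbrev onOuter (M : Register n →L[ℂ] Register n) : Extended H n →L[ℂ] Extended H n :=
  hmap 1 M

/-- The abstract swap with `(s, t)` on the outer (primed) register and `(s', t')` on the inner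
(doubly primed) one. The sign of `σ_y` ends up as `σ_z` of the inner register. -/
theorem exists_localUnitary [CompleteSpace H] {p : H →L[ℂ] H} {a : Fin n → Fin 3 → H →L[ℂ] H}
    (h : IsPauliSystem p a) :
    ∃ U ∈ unitary (Extended H n →L[ℂ] Extended H n), ∀ j,
      U ∘L zeros H n ∘L a j 0 = onOuter (onQubit σz j) ∘L U ∘L zeros H n ∘L p ∧
      U ∘L zeros H n ∘L a j 1 = onOuter (onQubit σx j) ∘L U ∘L zeros H n ∘L p ∧
      U ∘L zeros H n ∘L IsPauliSystem.chirality a j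
        = onInner (onQubit σz j) ∘L U ∘L zeros H n ∘L p ∧
      U ∘L zeros H n ∘L a j 2
        = onInner (onQubit σz j) ∘L onOuter (onQubit σy j) ∘L U ∘L zeros H n ∘L p := by
  let e₁ := ampL H (Register n)
  let e₂ := ampL (HTensor H (Register n)) (Register n)
  let r₁ := ampR H (Register n)
  let r₂ := ampR (HTensor H (Register n)) (Register n)
  have hq := isQubitSystem_onQubit n
  have c1 : ∀ T M, Commute (e₂ (e₁ T)) (r₂ M) := fun T M => commute_ampL_ampR _ _
  have c2 : ∀ T M, Commute (e₂ (e₁ T)) (e₂ (r₁ M)) := fun T M => (commute_ampL_ampR T M).map e₂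
  have c3 : ∀ M N, Commute (r₂ M) (e₂ (r₁ N)) := fun M N => (commute_ampL_ampR _ _).symm
  obtain ⟨U, hU, key⟩ := exists_unitary_swap ((h.map e₁).map e₂) (hq.map r₂) ((hq.map r₁).map e₂)
    (fun _ _ _ => c1 _ _) (fun _ _ _ => c1 _ _) (fun _ _ _ => c2 _ _) (fun _ _ _ => c2 _ _)
    (fun _ => c1 _ _) (fun _ => c1 _ _) (fun _ => c2 _ _) (fun _ => c2 _ _)
    (fun _ _ => c3 _ _) (fun _ _ => c3 _ _) (fun _ _ => c3 _ _) (fun _ _ => c3 _ _)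
  have hz : ∀ T, zeros H n ∘L T = e₂ (e₁ T) ∘L zeros H n := fun T => by
    ext x
    simp [e₁, e₂, ampL_def, zeros_apply, hmap_htmul]
  have hin : ∀ j, e₂ (r₁ (onQubit σz j)) ∘L zeros H n = zeros H n := fun j => by
    ext x
    simp [r₁, e₂, ampL_def, ampR_def, zeros_apply, hmap_htmul, onQubit_σz_ket_zero]
  have hout : ∀ j, r₂ (onQubit σz j) ∘L zeros H n = zeros H n := fun j => by
    ext x
    simp [r₂, ampR_def, zeros_apply, hmap_htmul, onQubit_σz_ket_zero]
  have hχ : ∀ j, IsPauliSystem.chirality (fun i s => e₂ (e₁ (a i s))) j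
      = e₂ (e₁ (IsPauliSystem.chirality a j)) := fun j => by
    simp [IsPauliSystem.chirality]
  refine ⟨U, hU, fun j => ?_⟩
  obtain ⟨k0, k1, k2, k3⟩ := key j
  rw [hχ] at k2
  refine ⟨?_, ?_, ?_, ?_⟩
  · rw [hz, hz p]
    -- `σ_z` fixes `|0⟩`, so the factor `t j` required by the swap relation may be inserted.
    conv_lhs => rw [← hout j]
    exact congrArg (· ∘L zeros H n) k0
  · rw [hz, hz p]
    exact congrArg (· ∘L zeros H n) k1
  · rw [hz, hz p]
    conv_lhs => rw [← hin j]
    exact congrArg (· ∘L zeros H n) k2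
  · have hy : Complex.I • (r₂ (onQubit σx j) * r₂ (onQubit σz j)) = r₂ (onQubit σy j) := by
      rw [← map_mul, ← map_smul, onQubit_mul, ← onQubit_smul, ← σy_eq]
    rw [hy] at k3
    rw [hz, hz p]
    conv_lhs => rw [← hin j, ← hout j]
    have : e₂ (r₁ (onQubit σz j)) ∘L r₂ (onQubit σz j) ∘L zeros H n
        = r₂ (onQubit σz j) ∘L e₂ (r₁ (onQubit σz j)) ∘L zeros H n := 
      congrArg (· ∘L zeros H n) (c3 (onQubit σz j) (onQubit σz j)).eq.symm
    rw [this]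
    exact congrArg (· ∘L zeros H n) k3

end LocalUnitary

/-! ### Support of the reduced state -/

section SupportProjection

variable {E F : Type*} [NormedAddCommGroup E] [InnerProductSpace ℂ E]
  [NormedAddCommGroup F] [InnerProductSpace ℂ F]

/-- The swap `E ⊗ F → F ⊗ E`. -/
noncomputable def hswap (E F : Type*) [NormedAddCommGroup E] [InnerProductSpace ℂ E]
    [NormedAddCommGroup F] [InnerProductSpace ℂ F] : HTensor E F →L[ℂ] HTensor F E :=
  ((TensorProduct.commIsometry ℂ E F).toLinearIsometry.toContinuousLinearMap.completion :
    UniformSpace.Completion (E ⊗[ℂ] F) →L[ℂ] UniformSpace.Completion (F ⊗[ℂ] E))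

theorem hswap_htmul (x : E) (y : F) : hswap E F (htmul x y) = htmul y x :=
  ContinuousLinearMap.completion_apply_coe
    (TensorProduct.commIsometry ℂ E F).toLinearIsometry.toContinuousLinearMap (x ⊗ₜ[ℂ] y)

theorem hswap_hswap (v : HTensor E F) : hswap F E (hswap E F v) = v := by
  have : hswap F E ∘L hswap E F = 1 := clm_ext_htmul fun x y => by simp [hswap_htmul]
  exact DFunLike.congr_fun this v

theorem hswap_hmap (f : E →L[ℂ] E) (g : F →L[ℂ] F) (v : HTensor E F) :
    hswap E F (hmap f g v) = hmap g f (hswap E F v) := by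
  have : hswap E F ∘L hmap f g = hmap g f ∘L hswap E F :=
    clm_ext_htmul fun x y => by simp [hswap_htmul, hmap_htmul]
  exact DFunLike.congr_fun this v

variable [CompleteSpace E] [CompleteSpace F]

/-- The support projection of the first reduced state of `ψ`. -/
theorem exists_supportProjection_left (ψ : HTensor E F) :
    ∃ p : E →L[ℂ] E, IsStarProjection p ∧ hmap p (1 : F →L[ℂ] F) ψ = ψ ∧
      ∀ T : E →L[ℂ] E, hmap T (1 : F →L[ℂ] F) ψ = 0 → T * p = 0 := by
  -- `L` consists of the `x` with `x ⊗ y ⟂ ψ` for all `y`, the kernel of the reduced state; the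
  -- support projection is the projection onto its orthogonal complement. If `T` kills `ψ`, then
  -- `T*` maps into `L`, which is the adjoint form of `T p = 0`.
  let L : Submodule ℂ E := ⨅ y : F, LinearMap.ker
    ((innerSL ℂ ψ ∘L (tensorRight y : E →L[ℂ] HTensor E F)).toLinearMap)
  have hL : ∀ x, x ∈ L ↔ ∀ y, inner ℂ (htmul x y) ψ = 0 := fun x => by
    simp only [L, Submodule.mem_iInf, LinearMap.mem_ker]
    exact forall_congr' fun y => inner_eq_zero_symm (𝕜 := ℂ) (x := ψ) (y := htmul x y)
  have hclosed : IsClosed (L : Set E) := by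
    have : (L : Set E) = ⋂ y : F, (innerSL ℂ ψ ∘L (tensorRight y : E →L[ℂ] HTensor E F)) ⁻¹' {0} := by
      ext x; simp [L]
    rw [this]
    exact isClosed_iInter fun y => isClosed_singleton.preimage (ContinuousLinearMap.continuous _)
  have : CompleteSpace L := hclosed.completeSpace_coe
  have hQ : IsStarProjection L.starProjection := isStarProjection_starProjection
  have inner_ampL : ∀ (T : E →L[ℂ] E) (x : E) (y : F),
      inner ℂ (htmul x y) (hmap T (1 : F →L[ℂ] F) ψ) = inner ℂ (htmul (star T x) y) ψ := by
    intro T x y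
    have h : htmul (star T x) y = (ampL E F (star T)) (htmul x y) := by
      rw [ampL_def, hmap_htmul]; rfl
    rw [h, map_star, ContinuousLinearMap.star_eq_adjoint, ContinuousLinearMap.adjoint_inner_left,
      ampL_def]
  refine ⟨1 - L.starProjection, hQ.one_sub, ?_, fun T hT => ?_⟩
  · have h0 : hmap L.starProjection (1 : F →L[ℂ] F) ψ = 0 := by
      refine eq_zero_of_inner_htmul fun x y => ?_
      rw [inner_ampL, hQ.isSelfAdjoint.star_eq]
      exact (hL _).1 (L.starProjection_apply_mem x) y
    rw [← ampL_def, map_sub, map_one, sub_apply, ampL_def, h0, sub_zero]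
    rfl
  · have h0 : L.starProjection * star T = star T := by
      ext x
      refine Submodule.starProjection_eq_self_iff.2 ((hL _).2 fun y => ?_)
      exact (inner_ampL T x y).symm.trans (by rw [hT, inner_zero_right])
    have h1 := congrArg star h0
    rw [star_mul, star_star, hQ.isSelfAdjoint.star_eq] at h1
    rw [mul_sub, mul_one, h1, sub_self]

end SupportProjection

/-! ### States stabilised by correlated Pauli operators -/

section StabilizedStates

variable {E F : Type*} [NormedAddCommGroup E] [InnerProductSpace ℂ E] [CompleteSpace E]
  [NormedAddCommGroup F] [InnerProductSpace ℂ F] [CompleteSpace F] {n : ℕ}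

omit [CompleteSpace E] [CompleteSpace F] in
theorem onCharlieQubit_apply (σ : Matrix (Fin 2) (Fin 2) ℂ) (j : Fin n)
    (v : HTensor (HTensor E (Register n)) F) :
    onCharlieQubit σ j v = hmap (hmap (1 : E →L[ℂ] E) (onQubit σ j)) (1 : F →L[ℂ] F) v := rfl

/-- The one-qubit operator `σ` acting on the `j`-th qubit of the register of the second party. -/
noncomputable def onAliceQubit (σ : Matrix (Fin 2) (Fin 2) ℂ) (j : Fin n) :
    HTensor E (HTensor F (Register n)) →L[ℂ] HTensor E (HTensor F (Register n)) :=
  hmap 1 (hmap 1 (onQubit σ j))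

omit [CompleteSpace E] [CompleteSpace F] in
theorem onAliceQubit_apply (σ : Matrix (Fin 2) (Fin 2) ℂ) (j : Fin n)
    (v : HTensor E (HTensor F (Register n))) :
    onAliceQubit σ j v = hmap (1 : E →L[ℂ] E) (hmap (1 : F →L[ℂ] F) (onQubit σ j)) v := rfl

theorem component_hmap_left (v : HTensor (HTensor E (Register n)) (HTensor F (Register n)))
    (b b' : Bits n) (f : E →L[ℂ] E) (M : Register n →L[ℂ] Register n) :
    component b b' (hmap (hmap f M) 1 v) =
      hmap f (1 : F →L[ℂ] F) (hmap (tensorRight (M.adjoint (ket b)) : E →L[ℂ] _).adjoint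
        (tensorRight (ket b') : F →L[ℂ] _).adjoint v) := by
  rw [component, hmap_hmap, hmap_hmap, adjoint_tensorRight_comp_hmap]
  rfl

theorem component_hmap_right (v : HTensor (HTensor E (Register n)) (HTensor F (Register n)))
    (b b' : Bits n) (g : F →L[ℂ] F) (M : Register n →L[ℂ] Register n) :
    component b b' (hmap 1 (hmap g M) v) =
      hmap (1 : E →L[ℂ] E) g (hmap (tensorRight (ket b) : E →L[ℂ] _).adjoint
        (tensorRight (M.adjoint (ket b')) : F →L[ℂ] _).adjoint v) := by
  rw [component, hmap_hmap, hmap_hmap, adjoint_tensorRight_comp_hmap]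
  rfl

theorem adjoint_onQubit_σz (j : Fin n) : (onQubit σz j).adjoint = onQubit σz j :=
  (isSelfAdjoint_onQubit_σz j).adjoint_eq

theorem adjoint_onQubit_σx (j : Fin n) : (onQubit σx j).adjoint = onQubit σx j :=
  (isSelfAdjoint_onQubit_σx j).adjoint_eq

theorem bitSign_inj {a b : Fin 2} (h : bitSign a = bitSign b) : a = b := by
  revert h
  fin_cases a <;> fin_cases b <;> simp [bitSign] <;> norm_num

theorem conj_bitSign (a : Fin 2) : starRingEnd ℂ (bitSign a) = bitSign a := by
  unfold bitSign; split_ifs <;> simp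

theorem adjoint_tensorRight_smul (c : ℂ) (y : Register n) :
    (tensorRight (c • y) : E →L[ℂ] HTensor E (Register n)).adjoint
      = starRingEnd ℂ c • (tensorRight y).adjoint := by
  rw [tensorRight_smul, map_smulₛₗ]

variable {v : HTensor (HTensor E (Register n)) (HTensor F (Register n))}

/-- A vector on which the operators `σ_z` of the two registers agree is a superposition of the
vectors `|q q⟩` of these registers. -/
theorem eq_sum_attach_of_σz (hz : ∀ j, onCharlieQubit σz j v = onAliceQubit σz j v) :
    v = ∑ q, attach (component q q v) (ket₂ q q) := by
  have h0 : ∀ b b', b ≠ b' → component b b' v = 0 := by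
    intro b b' hb
    obtain ⟨j, hj⟩ := Function.ne_iff.1 hb
    have h := congrArg (component b b') (hz j)
    rw [onCharlieQubit_apply, onAliceQubit_apply, component_hmap_left, component_hmap_right, adjoint_onQubit_σz, onQubit_σz_ket,
      onQubit_σz_ket, adjoint_tensorRight_smul, adjoint_tensorRight_smul, hmap_smul_left,
      hmap_smul_right, conj_bitSign, conj_bitSign, hmap_one] at h
    -- The two `σ_z` multiply the component at `(b, b')` by the signs of `b j` and `b' j`, which
    -- differ.
    have h' : (bitSign (b j) - bitSign (b' j)) • component b b' v = 0 := by
      rw [sub_smul, sub_eq_zero]; exact h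
    refine (smul_eq_zero.1 h').resolve_left fun h2 => hj (bitSign_inj (sub_eq_zero.1 h2))
  conv_lhs => rw [← sum_component v]
  refine Finset.sum_congr rfl fun b _ => Finset.sum_eq_single b (fun b' _ hb => ?_) (by simp)
  rw [h0 b b' hb.symm, attach_ket₂, map_zero]

/-- Every bit string arises from `0` by flips at single positions; the induction is over the set of
positions where `b` has already replaced `0`. -/
theorem eq_apply_zero_of_flip {X : Type*} {g : Bits n → X}
    (h : ∀ b j, g (Function.update b j (b j + 1)) = g b) (b : Bits n) : g b = g 0 := by
  have : ∀ s : Finset (Fin n), g (s.piecewise b 0) = g 0 := by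
    intro s
    induction s using Finset.induction_on with
    | empty => simp
    | insert j s hj ih =>
      rw [Finset.piecewise_insert, ← ih]
      have hv : s.piecewise b 0 j = 0 := by simp [hj]
      rcases Fin.exists_fin_two.1 ⟨b j, rfl⟩ with hc | hc
      · rw [hc, ← hv, Function.update_eq_self]
      · rw [← h (s.piecewise b 0) j, hv, hc]; rfl
  simpa using this Finset.univ

theorem component_diag_eq (hx : ∀ j, onCharlieQubit σx j v = onAliceQubit σx j v) (b : Bits n) :
    component b b v = component 0 0 v := by
  refine eq_apply_zero_of_flip (g := fun b => component b b v) (fun b j => ?_) b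
  have h2 : ∀ a : Fin 2, a + 1 + 1 = a := by decide
  -- At the component `(b, b')`, with `b'` the flip of `b` at `j`, Charlie's `σ_x` reads the
  -- component at `(b', b')` and Alice's the one at `(b, b)`.
  have h := congrArg (component b (Function.update b j (b j + 1))) (hx j)
  rw [onCharlieQubit_apply, onAliceQubit_apply, component_hmap_left, component_hmap_right, adjoint_onQubit_σx, onQubit_σx_ket,
    onQubit_σx_ket, hmap_one] at h
  simpa [h2, component] using h

theorem phiPlusPow_apply (b b' : Bits n) :
    phiPlusPow n (b, b') = if b = b' then (((√2 : ℝ) : ℂ)⁻¹) ^ n else 0 := by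
  change ∏ i, phiPlus (b i) (b' i) = _
  split_ifs with h
  · subst h; simp [phiPlus]
  · obtain ⟨j, hj⟩ := Function.ne_iff.1 h
    exact Finset.prod_eq_zero (Finset.mem_univ j) (by simp [phiPlus, hj])

omit [CompleteSpace E] [CompleteSpace F] in
theorem attach_phiPlusPow (w : HTensor E F) :
    attach w (phiPlusPow n) = (((√2 : ℝ) : ℂ)⁻¹) ^ n • ∑ b, attach w (ket₂ (n := n) b b) := by
  conv_lhs => rw [attach]
  rw [Finset.smul_sum]
  refine Finset.sum_congr rfl fun b _ => ?_
  rw [Finset.sum_eq_single b, phiPlusPow_apply, if_pos rfl, attach_ket₂]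
  · intro b' _ hb
    rw [phiPlusPow_apply, if_neg hb.symm, zero_smul]
  · simp

theorem sqrt_two_pow_ne_zero (n : ℕ) : (((√2 : ℝ) : ℂ)) ^ n ≠ 0 :=
  pow_ne_zero _ (by simp)

/-- A vector on which the operators `σ_z` and `σ_x` of the two registers agree contains maximally
entangled pairs of qubits. -/
theorem eq_attach_phiPlusPow (hz : ∀ j, onCharlieQubit σz j v = onAliceQubit σz j v)
    (hx : ∀ j, onCharlieQubit σx j v = onAliceQubit σx j v) :
    v = attach ((((√2 : ℝ) : ℂ)) ^ n • component 0 0 v) (phiPlusPow n) := by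
  conv_lhs => rw [eq_sum_attach_of_σz hz]
  rw [attach_phiPlusPow, Finset.smul_sum]
  refine Finset.sum_congr rfl fun b _ => ?_
  rw [component_diag_eq hx b, attach_ket₂, attach_ket₂, map_smul, smul_smul, inv_pow,
    inv_mul_cancel₀ (sqrt_two_pow_ne_zero n), one_smul]

-- `attach w (phiPlusPow n)` has `2 ^ n` mutually orthogonal terms, each of squared norm `2⁻ⁿ ‖w‖²`.
omit v in
theorem norm_attach_phiPlusPow (w : HTensor E F) : ‖attach w (phiPlusPow n)‖ = ‖w‖ := by
  have hT : ∀ b c : Bits n, inner ℂ (attach w (ket₂ b b)) (attach w (ket₂ c c))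
      = if b = c then inner ℂ w w else 0 := by
    intro b c
    rw [attach_ket₂, attach_ket₂, ← ContinuousLinearMap.adjoint_inner_right, adjoint_hmap, hmap_hmap,
      adjoint_tensorRight_comp, adjoint_tensorRight_comp, inner_ket_ket]
    split_ifs
    · rw [one_smul, one_smul, hmap_one]; rfl
    · rw [zero_smul, ← zero_smul ℂ (1 : E →L[ℂ] E), hmap_smul_left, zero_smul]; simp
  have h1 : inner ℂ (attach w (phiPlusPow n)) (attach w (phiPlusPow n)) = inner ℂ w w := by
    rw [attach_phiPlusPow, inner_smul_left, inner_smul_right, sum_inner]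
    simp only [inner_sum, hT, Finset.sum_ite_eq, Finset.mem_univ, if_true, Finset.sum_const]
    rw [Finset.card_univ, Fintype.card_fun, Fintype.card_fin, Fintype.card_fin, nsmul_eq_mul,
      ← mul_assoc, ← mul_assoc]
    convert one_mul _
    rw [← Complex.ofReal_inv, ← Complex.ofReal_pow, Complex.conj_ofReal, ← Complex.ofReal_mul,
      ← mul_pow, ← mul_inv, Real.mul_self_sqrt zero_le_two]
    push_cast
    rw [← mul_pow]
    norm_num
  rw [← sq_eq_sq₀ (norm_nonneg _) (norm_nonneg _)]
  rw [inner_self_eq_norm_sq_to_K, inner_self_eq_norm_sq_to_K] at h1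
  exact_mod_cast h1

end StabilizedStates

/-! ### Tensor products of isometries -/

section Isometries

variable {E F G H : Type*}
  [NormedAddCommGroup E] [InnerProductSpace ℂ E] [CompleteSpace E]
  [NormedAddCommGroup F] [InnerProductSpace ℂ F] [CompleteSpace F]
  [NormedAddCommGroup G] [InnerProductSpace ℂ G] [CompleteSpace G]
  [NormedAddCommGroup H] [InnerProductSpace ℂ H] [CompleteSpace H]

theorem norm_hmap_of_isometry {f : E →L[ℂ] F} {g : G →L[ℂ] H} (hf : f.adjoint ∘L f = 1)
    (hg : g.adjoint ∘L g = 1) (v : HTensor E G) : ‖hmap f g v‖ = ‖v‖ := by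
  refine (ContinuousLinearMap.norm_map_iff_adjoint_comp_self _).2 ?_ v
  rw [adjoint_hmap, ← hmap_comp, hf, hg, hmap_one]

theorem adjoint_comp_unitary_comp {U : F →L[ℂ] F} (hU : U ∈ unitary (F →L[ℂ] F)) {f : E →L[ℂ] F}
    (hf : f.adjoint ∘L f = 1) : (U ∘L f).adjoint ∘L (U ∘L f) = 1 := by
  have h : U.adjoint ∘L U = 1 := hU.1
  rw [ContinuousLinearMap.adjoint_comp, ContinuousLinearMap.comp_assoc,
    ← ContinuousLinearMap.comp_assoc _ U, h]
  exact hf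

end Isometries

/-! ### From relations on the state to self-testing -/

section Correlated

variable {E F : Type*} [NormedAddCommGroup E] [InnerProductSpace ℂ E] [CompleteSpace E]
  [NormedAddCommGroup F] [InnerProductSpace ℂ F] [CompleteSpace F]

/-- The operators `S` and `T` of the two parties act in the same way on `ψ`. -/
def Correlated (ψ : HTensor E F) (S : E →L[ℂ] E) (T : F →L[ℂ] F) : Prop :=
  ampL E F S ψ = ampR E F T ψ

namespace Correlated

variable {ψ : HTensor E F} {S S' : E →L[ℂ] E} {T T' : F →L[ℂ] F}

theorem ampL_ampR (S : E →L[ℂ] E) (T : F →L[ℂ] F) (v : HTensor E F) :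
    ampL E F S (ampR E F T v) = ampR E F T (ampL E F S v) :=
  DFunLike.congr_fun (commute_ampL_ampR S T).eq v

/-- `S S' ψ = S T' ψ = T' S ψ = T' T ψ`: passing to the other party reverses products, like the
transpose on a maximally entangled state. -/
theorem mul (h : Correlated ψ S T) (h' : Correlated ψ S' T') :
    Correlated ψ (S * S') (T' * T) := by
  unfold Correlated at *
  rw [map_mul, map_mul, mul_apply_eq_comp, mul_apply_eq_comp, h', ampL_ampR, h]

theorem add (h : Correlated ψ S T) (h' : Correlated ψ S' T') :
    Correlated ψ (S + S') (T + T') := by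
  unfold Correlated at *
  rw [map_add, map_add, add_apply, add_apply, h, h']

theorem sub (h : Correlated ψ S T) (h' : Correlated ψ S' T') :
    Correlated ψ (S - S') (T - T') := by
  unfold Correlated at *
  rw [map_sub, map_sub, sub_apply, sub_apply, h, h']

theorem smul (c : ℂ) (h : Correlated ψ S T) : Correlated ψ (c • S) (c • T) := by
  unfold Correlated at *
  rw [map_smul, map_smul, smul_apply, smul_apply, h]

theorem swap (h : Correlated ψ S T) : Correlated (hswap E F ψ) T S := by
  unfold Correlated at *
  rw [ampL_def, ampR_def] at *
  rw [← hswap_hmap, ← hswap_hmap, h]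

end Correlated

variable {n : ℕ}

/-- Families of operators of the two parties that act in the same way on `ψ`, and that satisfy on
`ψ` the relations of the Pauli operators `σ_z`, `σ_x`, `σ_y` (with indices `0`, `1`, `2`) of `n`
qubits, apart from `σ_x σ_y σ_z = i`. -/
structure IsCorrelatedPauli (ψ : HTensor E F) (a : Fin n → Fin 3 → E →L[ℂ] E)
    (a' : Fin n → Fin 3 → F →L[ℂ] F) : Prop where
  isSelfAdjoint_left : ∀ i s, IsSelfAdjoint (a i s)
  isSelfAdjoint_right : ∀ i s, IsSelfAdjoint (a' i s)
  correlated : ∀ i s, Correlated ψ (a i s) (a' i s)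
  mul_self : ∀ i s, ampL E F (a i s * a i s) ψ = ψ
  anticomm : ∀ i s t, s ≠ t → ampL E F (a i s * a i t + a i t * a i s) ψ = 0
  comm : ∀ i k s t, i ≠ k → ampL E F (a i s * a k t - a k t * a i s) ψ = 0

namespace IsCorrelatedPauli

variable {ψ : HTensor E F} {a : Fin n → Fin 3 → E →L[ℂ] E} {a' : Fin n → Fin 3 → F →L[ℂ] F}
  (h : IsCorrelatedPauli ψ a a')

include h

/-- The reversal of products leaves the anticommutators unchanged and permutes the commutators up to
relabelling, so Alice's operators inherit all relations. -/
theorem swap : IsCorrelatedPauli (hswap E F ψ) a' a where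
  isSelfAdjoint_left := h.isSelfAdjoint_right
  isSelfAdjoint_right := h.isSelfAdjoint_left
  correlated i s := (h.correlated i s).swap
  mul_self i s := by
    rw [ampL_def, ← hswap_hmap, ← ampR_def,
      ← ((h.correlated i s).mul (h.correlated i s) : ampL E F _ ψ = _), h.mul_self]
  anticomm i s t hst := by
    rw [ampL_def, ← hswap_hmap, ← ampR_def,
      ← (((h.correlated i t).mul (h.correlated i s)).add
        ((h.correlated i s).mul (h.correlated i t)) : ampL E F _ ψ = _),
      h.anticomm i t s hst.symm, map_zero]
  comm i k s t hik := by
    rw [ampL_def, ← hswap_hmap, ← ampR_def,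
      ← (((h.correlated k t).mul (h.correlated i s)).sub
        ((h.correlated i s).mul (h.correlated k t)) : ampL E F _ ψ = _),
      h.comm k i t s hik.symm, map_zero]

/-- On the support of the reduced state the relations hold exactly. -/
theorem exists_isPauliSystem : ∃ p : E →L[ℂ] E, ampL E F p ψ = ψ ∧
    (∀ i s, a i s * p = p * a i s) ∧ IsPauliSystem p (fun i s => a i s * p) := by
  obtain ⟨p, hp, hpψ, hker⟩ := exists_supportProjection_left ψ
  rw [← ampL_def] at hpψ
  have hpp : p * p = p := hp.isIdempotentElem
  have hsp : star p = p := hp.isSelfAdjoint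
  -- `(1 - p) a ψ = (1 - p) a' ψ = a' (1 - p) ψ = 0`, so `a` preserves the support, and by
  -- self-adjointness it commutes with `p`.
  have hcomm : ∀ i s, a i s * p = p * a i s := by
    intro i s
    have h1 : ((1 - p) * a i s) * p = 0 := by
      refine hker _ ?_
      rw [← ampL_def, map_mul, mul_apply_eq_comp, h.correlated i s, Correlated.ampL_ampR, map_sub,
        map_one, sub_apply, hpψ, one_apply_eq_self, sub_self, map_zero]
    have h2 : a i s * p = p * a i s * p := by
      rwa [sub_mul, sub_mul, one_mul, sub_eq_zero] at h1
    have h3 := congrArg star h2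
    rw [star_mul, star_mul, star_mul, hsp, (h.isSelfAdjoint_left i s).star_eq, ← mul_assoc] at h3
    exact h2.trans h3.symm
  have hmul : ∀ i k s t, a i s * p * (a k t * p) = a i s * a k t * p := fun i k s t => by
    rw [hcomm k t, ← mul_assoc, mul_assoc (a i s), hpp, mul_assoc, ← hcomm k t, mul_assoc]
  refine ⟨p, hpψ, hcomm, hp, fun i s => ?_, fun i s => ?_, fun i s => ?_, fun i s t hst => ?_,
    fun i k s t hik => ?_⟩
  · rw [IsSelfAdjoint, star_mul, hsp, (h.isSelfAdjoint_left i s).star_eq, hcomm]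
  · rw [mul_assoc, hpp]
  · rw [hmul]
    have : (a i s * a i s - 1) * p = 0 := hker _ (by
      rw [← ampL_def, map_sub, sub_apply, h.mul_self, map_one, one_apply_eq_self, sub_self])
    rwa [sub_mul, one_mul, sub_eq_zero] at this
  · rw [hmul, hmul]
    have := hker _ (h.anticomm i s t hst)
    rwa [add_mul, ← eq_neg_iff_add_eq_zero] at this
  · rw [Commute, SemiconjBy, hmul, hmul]
    have := hker _ (h.comm i k s t hik)
    rwa [sub_mul, sub_eq_zero] at this

end IsCorrelatedPauli

/-- Complex conjugation `σ_y ↦ -σ_y` preserves the relations. -/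
theorem IsPauliSystem.conj {A : Type*} [Ring A] [StarRing A] {p : A} {a : Fin n → Fin 3 → A}
    (h : IsPauliSystem p a) : IsPauliSystem p (fun i s => if s = 2 then -a i s else a i s) where
  isStarProjection := h.isStarProjection
  isSelfAdjoint i s := by
    split_ifs
    exacts [(h.isSelfAdjoint i s).neg, h.isSelfAdjoint i s]
  mul_proj i s := by split_ifs <;> simp [h.mul_proj]
  mul_self i s := by split_ifs <;> simp [h.mul_self]
  anticomm i s t hst := by split_ifs <;> simp [h.anticomm i s t hst]
  comm i k s t hik := by
    have := h.comm i k s t hik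
    split_ifs
    exacts [this.neg_left.neg_right, this.neg_left, this.neg_right, this]

/-- The chirality of the conjugated system is the reversed product, the form in which
`Correlated.mul` delivers Alice's partner of Charlie's chirality. -/
theorem chirality_conj {A : Type*} [Ring A] [StarRing A] [Algebra ℂ A] [StarModule ℂ A] {p : A}
    {a : Fin n → Fin 3 → A} (h : IsPauliSystem p a) (i : Fin n) :
    IsPauliSystem.chirality (fun i s => if s = 2 then -a i s else a i s) i
      = (-Complex.I) • (a i 0 * a i 2 * a i 1) := by
  have h1 := (h.isSelfAdjoint_chirality i).star_eq
  rw [IsPauliSystem.chirality, star_smul, star_mul, star_mul, (h.isSelfAdjoint i 0).star_eq,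
    (h.isSelfAdjoint i 1).star_eq, (h.isSelfAdjoint i 2).star_eq] at h1
  have h2 : (Complex.I) • (a i 0 * a i 2 * a i 1) = (-Complex.I) • (a i 1 * a i 2 * a i 0) := by
    rw [← h1, mul_assoc]; simp
  rw [neg_smul, h2]
  simp [IsPauliSystem.chirality]

/-- The intertwining is known only under `p`, which suffices because `p` fixes `ψ`. -/
theorem hmap_hmap_left_of_intertwines {E' F' : Type*} [NormedAddCommGroup E']
    [InnerProductSpace ℂ E'] [NormedAddCommGroup F'] [InnerProductSpace ℂ F'] {ψ : HTensor E F}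
    {p T : E →L[ℂ] E} {V : E →L[ℂ] E'} {M : E' →L[ℂ] E'} (W : F →L[ℂ] F')
    (hp : ampL E F p ψ = ψ) (h : V ∘L (T * p) = M ∘L V ∘L p) :
    hmap V W (hmap T (1 : F →L[ℂ] F) ψ) = hmap M (1 : F' →L[ℂ] F') (hmap V W ψ) := by
  conv_lhs => rw [← hp]
  conv_rhs => rw [← hp]
  rw [ampL_def, hmap_hmap, hmap_hmap, hmap_hmap, hmap_hmap]
  change hmap (V ∘L (T * p)) _ ψ = hmap (M ∘L V ∘L p) _ ψ
  rw [h]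
  rfl

theorem hmap_hmap_right_of_intertwines {E' F' : Type*} [NormedAddCommGroup E']
    [InnerProductSpace ℂ E'] [NormedAddCommGroup F'] [InnerProductSpace ℂ F'] {ψ : HTensor E F}
    {p T : F →L[ℂ] F} {V : F →L[ℂ] F'} {M : F' →L[ℂ] F'} (W : E →L[ℂ] E')
    (hp : ampR E F p ψ = ψ) (h : V ∘L (T * p) = M ∘L V ∘L p) :
    hmap W V (hmap (1 : E →L[ℂ] E) T ψ) = hmap (1 : E' →L[ℂ] E') M (hmap W V ψ) := by
  conv_lhs => rw [← hp]
  conv_rhs => rw [← hp]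
  rw [ampR_def, hmap_hmap, hmap_hmap, hmap_hmap, hmap_hmap]
  change hmap _ (V ∘L (T * p)) ψ = hmap _ (M ∘L V ∘L p) ψ
  rw [h]
  rfl

omit [CompleteSpace E] [CompleteSpace F] in
theorem component_zero_onInner_left
    (v : HTensor (HTensor (HTensor E (Register n)) (Register n))
      (HTensor (HTensor F (Register n)) (Register n))) (M : Register n →L[ℂ] Register n) :
    component 0 0 (hmap (onInner M) (1 : Extended F n →L[ℂ] Extended F n) v)
      = hmap (hmap (1 : E →L[ℂ] E) M) (1 : HTensor F (Register n) →L[ℂ] HTensor F (Register n))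
          (component 0 0 v) := by
  rw [component_hmap_left, ← ContinuousLinearMap.star_eq_adjoint (1 : Register n →L[ℂ] _), star_one]
  rfl

omit [CompleteSpace E] [CompleteSpace F] in
theorem component_zero_onInner_right
    (v : HTensor (HTensor (HTensor E (Register n)) (Register n))
      (HTensor (HTensor F (Register n)) (Register n))) (M : Register n →L[ℂ] Register n) :
    component 0 0 (hmap (1 : Extended E n →L[ℂ] Extended E n) (onInner M) v)
      = hmap (1 : HTensor E (Register n) →L[ℂ] HTensor E (Register n)) (hmap (1 : F →L[ℂ] F) M) (component 0 0 v) := by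
  rw [component_hmap_right, ← ContinuousLinearMap.star_eq_adjoint (1 : Register n →L[ℂ] _), star_one]
  rfl

theorem mul_proj_mul_proj_mul_proj {A : Type*} [Ring A] {p x y z : A} (hp : p * p = p)
    (hy : y * p = p * y) (hz : z * p = p * z) :
    x * p * (y * p) * (z * p) = x * y * z * p := by
  have h : ∀ {r q : A}, q * p = p * q → r * p * (q * p) = r * q * p := fun {r q} hq => by
    rw [hq, ← mul_assoc, mul_assoc r, hp, mul_assoc, ← hq, mul_assoc]
  rw [h hy, h hz]

/-- Self-testing of the Pauli operators from their relations on the state. -/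
theorem IsCorrelatedPauli.exists_localUnitary {ψ : HTensor E F} {a : Fin n → Fin 3 → E →L[ℂ] E}
    {a' : Fin n → Fin 3 → F →L[ℂ] F} (h : IsCorrelatedPauli ψ a a') (hψ : ‖ψ‖ = 1) :
    ∃ UC ∈ unitary (Extended E n →L[ℂ] Extended E n),
    ∃ UA ∈ unitary (Extended F n →L[ℂ] Extended F n),
    ∃ ξ : HTensor (HTensor E (Register n)) (HTensor F (Register n)),
      ‖ξ‖ = 1 ∧
      (∃ ξq : Bits n → HTensor E F, ξ = ∑ q, attach (ξq q) (ket₂ q q)) ∧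
      hmap UC UA (withZeros n ψ) = attach ξ (phiPlusPow n) ∧
      ∀ j : Fin n,
        hmap UC UA (withZeros n (hmap (a j 0) (ContinuousLinearMap.id ℂ F) ψ)) =
          onCharlieQubit σz j (attach ξ (phiPlusPow n)) ∧
        hmap UC UA (withZeros n (hmap (a j 1) (ContinuousLinearMap.id ℂ F) ψ)) =
          onCharlieQubit σx j (attach ξ (phiPlusPow n)) ∧
        hmap UC UA (withZeros n (hmap (a j 2) (ContinuousLinearMap.id ℂ F) ψ)) =
          onCharlieQubit σy j (attach (onCharlieQubit σz j ξ) (phiPlusPow n)) := by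
  obtain ⟨p, hpψ, hcp, hp⟩ := h.exists_isPauliSystem
  obtain ⟨p', hpψ', hcp', hp'⟩ := h.swap.exists_isPauliSystem
  replace hpψ' : ampR E F p' ψ = ψ := by
    rw [ampL_def, ← hswap_hmap] at hpψ'
    simpa only [hswap_hswap, ampR_def] using congrArg (hswap F E) hpψ'
  obtain ⟨UC, hUC, hC⟩ := PauliSelfTest.exists_localUnitary hp
  -- Correlation reverses products, so Alice's chirality matches Charlie's only after `σ_y ↦ -σ_y`
  -- on her side.
  obtain ⟨UA, hUA, hA⟩ := PauliSelfTest.exists_localUnitary hp'.conj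
  have hpp : p * p = p := hp.isStarProjection.isIdempotentElem
  have hpp' : p' * p' = p' := hp'.isStarProjection.isIdempotentElem
  set VC := UC ∘L zeros E n with hVC
  set VA := UA ∘L zeros F n with hVA
  have hU : ∀ v, hmap UC UA (withZeros n v) = hmap VC VA v := fun v => by
    rw [withZeros_eq, hmap_hmap]
  set Ω := hmap VC VA ψ with hΩ
  -- the action of the observables in the extracted frame
  have cz : ∀ j, hmap VC VA (hmap (a j 0) (1 : F →L[ℂ] F) ψ) = onCharlieQubit σz j Ω := fun j =>
    hmap_hmap_left_of_intertwines VA hpψ (hC j).1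
  have cx : ∀ j, hmap VC VA (hmap (a j 1) (1 : F →L[ℂ] F) ψ) = onCharlieQubit σx j Ω := fun j =>
    hmap_hmap_left_of_intertwines VA hpψ (hC j).2.1
  have cy : ∀ j, hmap VC VA (hmap (a j 2) (1 : F →L[ℂ] F) ψ)
      = hmap (onInner (onQubit σz j) * onOuter (onQubit σy j)) 1 Ω := fun j =>
    hmap_hmap_left_of_intertwines VA hpψ (hC j).2.2.2
  have az : ∀ j, hmap VC VA (hmap (1 : E →L[ℂ] E) (a' j 0) ψ) = onAliceQubit σz j Ω := fun j =>
    hmap_hmap_right_of_intertwines VC hpψ' (hA j).1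
  have ax : ∀ j, hmap VC VA (hmap (1 : E →L[ℂ] E) (a' j 1) ψ) = onAliceQubit σx j Ω := fun j =>
    hmap_hmap_right_of_intertwines VC hpψ' (hA j).2.1
  have hz : ∀ j, onCharlieQubit σz j Ω = onAliceQubit σz j Ω := fun j => by
    rw [← cz, ← az]; exact congrArg _ (h.correlated j 0)
  have hx : ∀ j, onCharlieQubit σx j Ω = onAliceQubit σx j Ω := fun j => by
    rw [← cx, ← ax]; exact congrArg _ (h.correlated j 1)
  -- the chirality of the two parties agrees
  let χ := fun j => (-Complex.I) • (a j 1 * a j 2 * a j 0)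
  let χ' := fun j => (-Complex.I) • (a' j 0 * a' j 2 * a' j 1)
  have hχ : ∀ j, Correlated ψ (χ j) (χ' j) := fun j => by
    have := ((h.correlated j 1).mul (h.correlated j 2)).mul (h.correlated j 0)
    rw [← mul_assoc] at this
    exact this.smul _
  have cχ : ∀ j, hmap VC VA (hmap (χ j) (1 : F →L[ℂ] F) ψ) = hmap (onInner (onQubit σz j)) 1 Ω :=
    fun j => hmap_hmap_left_of_intertwines VA hpψ (by
      refine Eq.trans ?_ (hC j).2.2.1
      rw [IsPauliSystem.chirality, mul_proj_mul_proj_mul_proj hpp (hcp _ _) (hcp _ _), hVC]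
      simp only [χ, smul_mul_assoc]
      rfl)
  have aχ : ∀ j, hmap VC VA (hmap (1 : E →L[ℂ] E) (χ' j) ψ) = hmap 1 (onInner (onQubit σz j)) Ω :=
    fun j => hmap_hmap_right_of_intertwines VC hpψ' (by
      refine Eq.trans ?_ (hA j).2.2.1
      rw [chirality_conj hp', mul_proj_mul_proj_mul_proj hpp' (hcp' _ _) (hcp' _ _), hVA]
      simp only [χ', smul_mul_assoc]
      rfl)
  have hzz : ∀ j, hmap (onInner (onQubit σz j)) 1 Ω = hmap 1 (onInner (onQubit σz j)) Ω := fun j => by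
    rw [← cχ, ← aχ]; exact congrArg _ (hχ j)
  -- The factor `√2 ^ n` undoes the amplitude of `|00⟩` in `⨂ Φ⁺`.
  set ξ := (((√2 : ℝ) : ℂ)) ^ n • component 0 0 Ω with hξ
  have hΩξ : Ω = attach ξ (phiPlusPow n) := eq_attach_phiPlusPow hz hx
  have hξz : ∀ j, onCharlieQubit σz j ξ = onAliceQubit σz j ξ := fun j => by
    have := congrArg (component 0 0) (hzz j)
    rw [component_zero_onInner_left, component_zero_onInner_right] at this
    rw [hξ, map_smul, map_smul]
    exact congrArg _ this
  refine ⟨UC, hUC, UA, hUA, ξ, ?_, ⟨_, eq_sum_attach_of_σz hξz⟩, ?_, fun j => ⟨?_, ?_, ?_⟩⟩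
  · rw [← norm_attach_phiPlusPow, ← hΩξ, hΩ, norm_hmap_of_isometry
      (adjoint_comp_unitary_comp hUC adjoint_zeros_comp)
      (adjoint_comp_unitary_comp hUA adjoint_zeros_comp), hψ]
  · rw [hU, ← hΩξ]
  · rw [hU, ← hΩξ]; exact cz j
  · rw [hU, ← hΩξ]; exact cx j
  · rw [hU, onCharlieQubit_apply σz, hmap_attach, ← hΩξ, hmap_one]
    refine (cy j).trans ?_
    -- The target applies `σ_z` to `ξ` before the primed register is attached, hence the exchange of
    -- the two commuting operators.
    have hc : onInner (onQubit σz j) * onOuter (onQubit σy j)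
        = onOuter (onQubit σy j) * onInner (H := E) (onQubit σz j) :=
      (commute_ampL_ampR (hmap (1 : E →L[ℂ] E) (onQubit σz j)) (onQubit σy j)).eq
    rw [hc]
    exact (hmap_hmap (onOuter (onQubit σy j)) (onInner (onQubit σz j))
      (1 : Extended F n →L[ℂ] Extended F n) 1 Ω).symm

end Correlated

/-! ### Averages of unit vectors and Tsirelson's bound -/

section InnerProductSpace

variable {V : Type*} [NormedAddCommGroup V] [InnerProductSpace ℂ V]

theorem norm_average_le {ι : Type*} {s : Finset ι} {v : ι → V} (hv : ∀ i ∈ s, ‖v i‖ = 1) :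
    ‖((s.card : ℂ))⁻¹ • ∑ i ∈ s, v i‖ ≤ 1 := by
  have h1 : ‖∑ i ∈ s, v i‖ ≤ s.card := by
    refine (norm_sum_le _ _).trans ?_
    rw [Finset.sum_congr rfl hv]; simp
  rw [norm_smul, norm_inv, Complex.norm_natCast]
  exact inv_mul_le_one_of_le₀ h1 (Nat.cast_nonneg _)

/-- An average of unit vectors that is itself a unit vector is constant. -/
theorem eq_average_of_norm_eq_one {ι : Type*} {s : Finset ι} {v : ι → V} {w : V}
    (hv : ∀ i ∈ s, ‖v i‖ = 1) (hw : w = ((s.card : ℂ))⁻¹ • ∑ i ∈ s, v i) (h : ‖w‖ = 1) :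
    ∀ i ∈ s, v i = w := by
  -- An empty average is `0`, which is not a unit vector.
  have hs : (s.card : ℂ) ≠ 0 := by
    intro h0
    rw [hw, h0] at h
    simp at h
  have h1 : ∑ i ∈ s, v i = (s.card : ℂ) • w := by rw [hw, smul_inv_smul₀ hs]
  -- With `N = s.card`, the sum of squared distances is `2N - 2 Re⟪∑ v i, w⟫ = 2N - 2N`.
  have h2 : ∑ i ∈ s, ‖v i - w‖ ^ 2 = 0 := by
    have : ∀ i ∈ s, ‖v i - w‖ ^ 2 = 2 - 2 * RCLike.re (inner ℂ (v i) w) := fun i hi => by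
      rw [norm_sub_sq (𝕜 := ℂ), hv i hi, h]; ring
    rw [Finset.sum_congr rfl this, Finset.sum_sub_distrib, ← Finset.mul_sum, ← map_sum, ← sum_inner,
      h1, inner_smul_left, inner_self_eq_norm_sq_to_K, h]
    simp
    ring
  intro i hi
  have h3 := (Finset.sum_eq_zero_iff_of_nonneg fun i _ => sq_nonneg ‖v i - w‖).1 h2 i hi
  rwa [sq_eq_zero_iff, norm_eq_zero, sub_eq_zero] at h3

/-- Sum of squares decomposition for Tsirelson's inequality. -/
theorem chsh_identity (a b d e : V) :
    ‖((√2 : ℝ) : ℂ) • a - (d + e)‖ ^ 2 + ‖((√2 : ℝ) : ℂ) • b - (d - e)‖ ^ 2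
      = 2 * (‖a‖ ^ 2 + ‖b‖ ^ 2 + ‖d‖ ^ 2 + ‖e‖ ^ 2)
        - 2 * √2 * RCLike.re (inner ℂ a (d + e) + inner ℂ b (d - e)) := by
  have h2 : √2 ^ 2 = 2 := Real.sq_sqrt zero_le_two
  have hn : ‖((√2 : ℝ) : ℂ)‖ = √2 := by simp
  have hp := parallelogram_law_with_norm ℂ d e
  rw [norm_sub_sq (𝕜 := ℂ), norm_sub_sq (𝕜 := ℂ), inner_smul_left, inner_smul_left, norm_smul,
    norm_smul, hn, mul_pow, mul_pow, h2, Complex.conj_ofReal, map_add]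
  have hr : ∀ z : ℂ, RCLike.re (((√2 : ℝ) : ℂ) * z) = √2 * RCLike.re z := fun z =>
    Complex.re_ofReal_mul _ _
  rw [hr, hr]
  linarith

theorem chsh_le {a b d e : V} (ha : ‖a‖ ≤ 1) (hb : ‖b‖ ≤ 1) (hd : ‖d‖ ≤ 1) (he : ‖e‖ ≤ 1) :
    RCLike.re (inner ℂ a (d + e) + inner ℂ b (d - e)) ≤ 2 * √2 := by
  have h := chsh_identity a b d e
  have h2 : √2 * √2 = 2 := Real.mul_self_sqrt zero_le_two
  have h0 : 0 < √2 := by positivity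
  have ha' : ‖a‖ ^ 2 ≤ 1 := pow_le_one₀ (norm_nonneg _) ha
  have hb' : ‖b‖ ^ 2 ≤ 1 := pow_le_one₀ (norm_nonneg _) hb
  have hd' : ‖d‖ ^ 2 ≤ 1 := pow_le_one₀ (norm_nonneg _) hd
  have he' : ‖e‖ ^ 2 ≤ 1 := pow_le_one₀ (norm_nonneg _) he
  have := sq_nonneg ‖((√2 : ℝ) : ℂ) • a - (d + e)‖
  have := sq_nonneg ‖((√2 : ℝ) : ℂ) • b - (d - e)‖
  refine le_of_mul_le_mul_left ?_ h0
  nlinarith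

/-- At the value `2√2` the identity says that two squares sum to `2 (‖a‖² + ‖b‖² + ‖d‖² + ‖e‖²) - 8
≤ 0`, so both squares vanish and every norm is one. -/
theorem chsh_eq {a b d e : V} (ha : ‖a‖ ≤ 1) (hb : ‖b‖ ≤ 1) (hd : ‖d‖ ≤ 1) (he : ‖e‖ ≤ 1)
    (h : RCLike.re (inner ℂ a (d + e) + inner ℂ b (d - e)) = 2 * √2) :
    ‖a‖ = 1 ∧ ‖b‖ = 1 ∧ ‖d‖ = 1 ∧
      ((√2 : ℝ) : ℂ) • a = d + e ∧ ((√2 : ℝ) : ℂ) • b = d - e := by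
  have hid := chsh_identity a b d e
  have h2 : √2 * √2 = 2 := Real.mul_self_sqrt zero_le_two
  rw [h, show 2 * √2 * (2 * √2) = 4 * (√2 * √2) by ring, h2] at hid
  have ha' : ‖a‖ ^ 2 ≤ 1 := pow_le_one₀ (norm_nonneg _) ha
  have hb' : ‖b‖ ^ 2 ≤ 1 := pow_le_one₀ (norm_nonneg _) hb
  have hd' : ‖d‖ ^ 2 ≤ 1 := pow_le_one₀ (norm_nonneg _) hd
  have he' : ‖e‖ ^ 2 ≤ 1 := pow_le_one₀ (norm_nonneg _) he
  have q1 := sq_nonneg ‖((√2 : ℝ) : ℂ) • a - (d + e)‖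
  have q2 := sq_nonneg ‖((√2 : ℝ) : ℂ) • b - (d - e)‖
  have one : ∀ {x : V}, ‖x‖ ^ 2 = 1 → ‖x‖ = 1 := fun {x} hx =>
    (pow_eq_one_iff_of_nonneg (norm_nonneg x) two_ne_zero).1 hx
  have zero : ∀ {x y : V}, ‖x - y‖ ^ 2 = 0 → x = y := fun {x y} hx => by
    rwa [sq_eq_zero_iff, norm_eq_zero, sub_eq_zero] at hx
  exact ⟨one (by linarith), one (by linarith), one (by linarith), zero (by linarith),
    zero (by linarith)⟩

end InnerProductSpace

/-! ### Observables of projective measurements and their averages -/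

section Observables

variable {H : Type*} [NormedAddCommGroup H] [InnerProductSpace ℂ H] [CompleteSpace H] {n m : ℕ}

namespace IsProjectiveMeasurement

variable {O : Type*} [Fintype O] {P : O → H →L[ℂ] H} (hP : IsProjectiveMeasurement P)

include hP

/-- For `x` in the range of `P d`, the sum of all `‖P e x‖²` is `‖x‖²`, which the term `e = d`
already exhausts. -/
theorem mul_eq_zero {c d : O} (hcd : c ≠ d) : P c * P d = 0 := by
  classical
  have hn : ∀ e x, ‖P e x‖ ^ 2 = RCLike.re (inner ℂ x (P e x)) := fun e x => by
    have h1 : P e (P e x) = P e x :=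
      DFunLike.congr_fun (hP.isStarProjection e).isIdempotentElem.eq x
    have h2 : (P e).adjoint = P e := (hP.isStarProjection e).isSelfAdjoint.adjoint_eq
    rw [← inner_self_eq_norm_sq (𝕜 := ℂ)]
    conv_lhs => rw [← ContinuousLinearMap.adjoint_inner_right, h2, h1]
  ext y
  set x := P d y with hx
  have hdx : P d x = x := DFunLike.congr_fun (hP.isStarProjection d).isIdempotentElem.eq y
  have hsum : ∑ e, ‖P e x‖ ^ 2 = ‖x‖ ^ 2 := by
    simp only [hn]
    rw [← map_sum, ← inner_sum, ← sum_apply, hP.sum_eq_one, one_apply_eq_self,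
      inner_self_eq_norm_sq]
  rw [← Finset.add_sum_erase _ _ (Finset.mem_univ d), hdx, add_eq_left,
    Finset.sum_eq_zero_iff_of_nonneg fun e _ => sq_nonneg _] at hsum
  have := hsum c (by simp [hcd])
  rwa [sq_eq_zero_iff, norm_eq_zero] at this

theorem sum_smul_mul_sum_smul (f g : O → ℂ) :
    (∑ c, f c • P c) * (∑ c, g c • P c) = ∑ c, (f c * g c) • P c := by
  classical
  rw [Finset.sum_mul_sum]
  refine Finset.sum_congr rfl fun c _ => ?_
  rw [Finset.sum_eq_single c]
  · rw [smul_mul_smul_comm, (hP.isStarProjection c).isIdempotentElem.eq]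
  · intro d _ hd
    rw [smul_mul_smul_comm, hP.mul_eq_zero hd.symm, smul_zero]
  · simp

end IsProjectiveMeasurement

omit [CompleteSpace H] in
theorem outcomeObs_eq (P : (Fin n → ℤˣ) → H →L[ℂ] H) (i : Fin n) :
    outcomeObs P i = ∑ c, (((c i : ℤˣ) : ℤ) : ℂ) • P c := by
  rw [outcomeObs, Finset.sum_filter, Finset.sum_filter, ← Finset.sum_sub_distrib]
  refine Finset.sum_congr rfl fun c _ => ?_
  rcases Int.units_eq_one_or (c i) with h | h <;> rw [h] <;> simp

theorem isSelfAdjoint_outcomeObs {P : (Fin n → ℤˣ) → H →L[ℂ] H} (hP : IsProjectiveMeasurement P)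
    (i : Fin n) : IsSelfAdjoint (outcomeObs P i) := by
  rw [outcomeObs_eq, IsSelfAdjoint, star_sum]
  refine Finset.sum_congr rfl fun c _ => ?_
  rw [star_smul, (hP.isStarProjection c).isSelfAdjoint.star_eq]
  simp

theorem outcomeObs_mul_self {P : (Fin n → ℤˣ) → H →L[ℂ] H} (hP : IsProjectiveMeasurement P)
    (i : Fin n) : outcomeObs P i * outcomeObs P i = 1 := by
  rw [outcomeObs_eq, hP.sum_smul_mul_sum_smul, ← hP.sum_eq_one]
  refine Finset.sum_congr rfl fun c _ => ?_
  rcases Int.units_eq_one_or (c i) with h | h <;> rw [h] <;> simp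

theorem commute_outcomeObs {P : (Fin n → ℤˣ) → H →L[ℂ] H} (hP : IsProjectiveMeasurement P)
    (i k : Fin n) : Commute (outcomeObs P i) (outcomeObs P k) := by
  rw [Commute, SemiconjBy, outcomeObs_eq, outcomeObs_eq, hP.sum_smul_mul_sum_smul,
    hP.sum_smul_mul_sum_smul]
  simp only [mul_comm]

theorem isSelfAdjoint_avgObs {P : (Fin n → Fin m) → (Fin n → ℤˣ) → H →L[ℂ] H}
    (hP : ∀ z, IsProjectiveMeasurement (P z)) (i : Fin n) (s : Fin m) :
    IsSelfAdjoint (avgObs P i s) := by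
  rw [avgObs, IsSelfAdjoint, star_smul, star_sum]
  congr 1
  · simp
  · exact Finset.sum_congr rfl fun z _ => isSelfAdjoint_outcomeObs (hP z) i

/-- Shows that `avgObs` is a true average. The existence of `i : Fin n` gives `n ≥ 1`, so `n - 1` is
not truncated. -/
theorem card_filter_apply_eq (i : Fin n) (s : Fin m) :
    (Finset.univ.filter fun z : Fin n → Fin m => z i = s).card = m ^ (n - 1) := by
  have := Fintype.card_filter_piFinset_const_eq_of_mem (Finset.univ : Finset (Fin m)) i
    (Finset.mem_univ s)
  simpa using this

variable {K : Type*} [NormedAddCommGroup K] [InnerProductSpace ℂ K] [CompleteSpace K]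
  {P : (Fin n → Fin m) → (Fin n → ℤˣ) → H →L[ℂ] H} (hP : ∀ z, IsProjectiveMeasurement (P z))
  (Θ : (H →L[ℂ] H) →⋆ₐ[ℂ] (K →L[ℂ] K)) {ψ : K}

/-- `Θ` will be `ampL` or `ampR`, so that the same arguments serve both parties. -/
theorem map_avgObs_apply (P : (Fin n → Fin m) → (Fin n → ℤˣ) → H →L[ℂ] H) (i : Fin n)
    (s : Fin m) :
    Θ (avgObs P i s) ψ = ((Finset.univ.filter fun z : Fin n → Fin m => z i = s).card : ℂ)⁻¹ •
      ∑ z with z i = s, Θ (outcomeObs (P z) i) ψ := by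
  rw [avgObs, map_smul, map_sum, smul_apply, sum_apply, card_filter_apply_eq]
  push_cast
  rfl

include hP

theorem map_outcomeObs_apply_apply (z : Fin n → Fin m) (i : Fin n) (v : K) :
    Θ (outcomeObs (P z) i) (Θ (outcomeObs (P z) i) v) = v := by
  rw [← mul_apply_eq_comp, ← map_mul, outcomeObs_mul_self (hP z), map_one, one_apply_eq_self]

theorem norm_map_outcomeObs_apply (z : Fin n → Fin m) (i : Fin n) (v : K) :
    ‖Θ (outcomeObs (P z) i) v‖ = ‖v‖ := by
  refine (ContinuousLinearMap.norm_map_iff_adjoint_comp_self _).2 ?_ v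
  rw [← ContinuousLinearMap.star_eq_adjoint, ← map_star, (isSelfAdjoint_outcomeObs (hP z) i).star_eq]
  exact (map_mul Θ _ _).symm.trans (by rw [outcomeObs_mul_self (hP z), map_one])

theorem norm_map_avgObs_apply_le (hψ : ‖ψ‖ = 1) (i : Fin n) (s : Fin m) :
    ‖Θ (avgObs P i s) ψ‖ ≤ 1 := by
  rw [map_avgObs_apply]
  exact norm_average_le fun z _ => (norm_map_outcomeObs_apply hP Θ z i ψ).trans hψ

theorem map_outcomeObs_apply_eq (hψ : ‖ψ‖ = 1) {i : Fin n} {s : Fin m}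
    (h : ‖Θ (avgObs P i s) ψ‖ = 1) {z : Fin n → Fin m} (hz : z i = s) :
    Θ (outcomeObs (P z) i) ψ = Θ (avgObs P i s) ψ :=
  eq_average_of_norm_eq_one (fun z _ => (norm_map_outcomeObs_apply hP Θ z i ψ).trans hψ)
    (map_avgObs_apply Θ P i s) h z (by simp [hz])

/-- If an averaged observable preserves the norm of `ψ`, then on the vectors that operators of the
other party produce from `ψ` it agrees with each of the averaged observables. -/
theorem map_avgObs_apply_apply (hψ : ‖ψ‖ = 1) {i : Fin n} {s : Fin m}
    (h : ‖Θ (avgObs P i s) ψ‖ = 1) {B : K →L[ℂ] K} (hB : ∀ T v, Θ T (B v) = B (Θ T v))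
    {z : Fin n → Fin m} (hz : z i = s) :
    Θ (avgObs P i s) (B ψ) = Θ (outcomeObs (P z) i) (B ψ) := by
  rw [hB, hB, map_outcomeObs_apply_eq hP Θ hψ h hz]

/-- With `M` the average and `O` one of the averaged observables, `M M ψ = M B ψ = O B ψ = O M ψ = O
O ψ = ψ`; the partner `B` is what allows replacing the outer `M`. -/
theorem map_avgObs_mul_self (hψ : ‖ψ‖ = 1) {i : Fin n} {s : Fin m}
    (h : ‖Θ (avgObs P i s) ψ‖ = 1) {B : K →L[ℂ] K} (hB : ∀ T v, Θ T (B v) = B (Θ T v))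
    (hψB : Θ (avgObs P i s) ψ = B ψ) : Θ (avgObs P i s * avgObs P i s) ψ = ψ := by
  obtain ⟨z, hz⟩ : ∃ z : Fin n → Fin m, z i = s := ⟨fun _ => s, rfl⟩
  rw [map_mul, mul_apply_eq_comp, hψB, map_avgObs_apply_apply hP Θ hψ h hB hz, ← hψB,
    ← map_outcomeObs_apply_eq hP Θ hψ h hz, map_outcomeObs_apply_apply hP]

/-- Both averages are replaced by observables of one joint measurement `z`, and those commute. -/
theorem map_avgObs_mul_avgObs (hψ : ‖ψ‖ = 1) {i k : Fin n} {s t : Fin m}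
    (h : ‖Θ (avgObs P i s) ψ‖ = 1) (h' : ‖Θ (avgObs P k t) ψ‖ = 1) {B : K →L[ℂ] K}
    (hB : ∀ T v, Θ T (B v) = B (Θ T v)) (hψB : Θ (avgObs P k t) ψ = B ψ)
    {z : Fin n → Fin m} (hz : z i = s) (hz' : z k = t) :
    Θ (avgObs P i s * avgObs P k t) ψ = Θ (outcomeObs (P z) i * outcomeObs (P z) k) ψ := by
  rw [map_mul, mul_apply_eq_comp, hψB, map_avgObs_apply_apply hP Θ hψ h hB hz, ← hψB,
    ← map_outcomeObs_apply_eq hP Θ hψ h' hz', map_mul, mul_apply_eq_comp]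

end Observables

/-! ### From the maximal Bell violation to the Pauli relations -/

section BellViolation

variable {HC HA : Type*} [NormedAddCommGroup HC] [InnerProductSpace ℂ HC] [CompleteSpace HC]
  [NormedAddCommGroup HA] [InnerProductSpace ℂ HA] [CompleteSpace HA] {ψ : HTensor HC HA}

theorem inner_hmap_of_isSelfAdjoint {S : HC →L[ℂ] HC} (hS : IsSelfAdjoint S) (T : HA →L[ℂ] HA) :
    inner ℂ ψ (hmap S T ψ) = inner ℂ (ampL HC HA S ψ) (ampR HC HA T ψ) := by
  rw [← ampL_mul_ampR, mul_apply_eq_comp, ← ContinuousLinearMap.adjoint_inner_left]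
  congr 2
  rw [← ContinuousLinearMap.star_eq_adjoint, ← map_star, hS.star_eq]

/-- A maximal violation of the CHSH inequality makes the first party's operators anticommute on the
state. -/
theorem anticomm_of_correlated {S T : HC →L[ℂ] HC} {D : HA →L[ℂ] HA}
    (hS : ampL HC HA (S * S) ψ = ψ) (hT : ampL HC HA (T * T) ψ = ψ)
    (hD : ampR HC HA (D * D) ψ = ψ)
    (h : Correlated ψ (S + T) (((√2 : ℝ) : ℂ) • D)) :
    ampL HC HA (S * T + T * S) ψ = 0 := by
  have h2 : (((√2 : ℝ) : ℂ)) * (((√2 : ℝ) : ℂ)) = 2 := by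
    rw [← Complex.ofReal_mul, Real.mul_self_sqrt zero_le_two]; norm_num
  -- Squaring the correlation gives `(S² + T² + ST + TS)ψ = 2 D²ψ = 2ψ`.
  have h1 : ampL HC HA _ ψ = ampR HC HA _ ψ := h.mul h
  rw [smul_mul_smul_comm, h2, map_smul, smul_apply, hD,
    show (S + T) * (S + T) = S * S + T * T + (S * T + T * S) by noncomm_ring, map_add, map_add,
    add_apply, add_apply, hS, hT, two_smul] at h1
  simpa using h1

variable {n : ℕ} {PC : (Fin n → Fin 3) → (Fin n → ℤˣ) → (HC →L[ℂ] HC)}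
  {PA : (Fin n → Fin 6) → (Fin n → ℤˣ) → (HA →L[ℂ] HA)}

/-- Alice's counterparts of Charlie's averaged observables. -/
noncomputable def partnerObs (PA : (Fin n → Fin 6) → (Fin n → ℤˣ) → (HA →L[ℂ] HA)) (i : Fin n) :
    Fin 3 → HA →L[ℂ] HA :=
  ![(((√2 : ℝ) : ℂ))⁻¹ • (Dzx PA i + Ezx PA i), (((√2 : ℝ) : ℂ))⁻¹ • (Dzx PA i - Ezx PA i),
    -((((√2 : ℝ) : ℂ))⁻¹ • (Dzy PA i - Ezy PA i))]

theorem isCorrelatedPauli_of_bellOp (hψ : ‖ψ‖ = 1) (hPC : ∀ z, IsProjectiveMeasurement (PC z))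
    (hPA : ∀ x, IsProjectiveMeasurement (PA x))
    (hB : ∀ i : Fin n, inner ℂ ψ (bellOp PC PA i ψ) = ((6 * √2 : ℝ) : ℂ)) :
    IsCorrelatedPauli ψ (avgObs PC) (partnerObs PA) := by
  have hsc := isSelfAdjoint_avgObs hPC
  have hsa := isSelfAdjoint_avgObs hPA
  have hnc := norm_map_avgObs_apply_le hPC (ampL HC HA) hψ
  have hna := norm_map_avgObs_apply_le hPA (ampR HC HA) hψ
  have hsqrt : (((√2 : ℝ) : ℂ)) ≠ 0 := by simp
  have key : ∀ i, (∀ s, ‖ampL HC HA (avgObs PC i s) ψ‖ = 1) ∧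
      (‖ampR HC HA (Dzx PA i) ψ‖ = 1 ∧ ‖ampR HC HA (Dzy PA i) ψ‖ = 1 ∧
        ‖ampR HC HA (Dxy PA i) ψ‖ = 1) ∧
      (((√2 : ℝ) : ℂ) • ampL HC HA (Zop PC i) ψ = ampR HC HA (Dzx PA i + Ezx PA i) ψ ∧
        ((√2 : ℝ) : ℂ) • ampL HC HA (Xop PC i) ψ = ampR HC HA (Dzx PA i - Ezx PA i) ψ) ∧
      (((√2 : ℝ) : ℂ) • ampL HC HA (Zop PC i) ψ = ampR HC HA (Dzy PA i + Ezy PA i) ψ ∧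
        ((√2 : ℝ) : ℂ) • ampL HC HA (-Yop PC i) ψ = ampR HC HA (Dzy PA i - Ezy PA i) ψ) ∧
      (((√2 : ℝ) : ℂ) • ampL HC HA (Xop PC i) ψ = ampR HC HA (Dxy PA i + Exy PA i) ψ ∧
        ((√2 : ℝ) : ℂ) • ampL HC HA (-Yop PC i) ψ = ampR HC HA (Dxy PA i - Exy PA i) ψ) := by
    intro i
    have hy : ‖-ampL HC HA (Yop PC i) ψ‖ ≤ 1 := by rw [norm_neg]; exact hnc i 2
    have hBi := congrArg RCLike.re (hB i)
    -- The Bell value splits into three CHSH expressions, the minus signs being absorbed into `-Y`.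
    have e : inner ℂ ψ (bellOp PC PA i ψ)
        = (inner ℂ (ampL HC HA (Zop PC i) ψ) (ampR HC HA (Dzx PA i) ψ + ampR HC HA (Ezx PA i) ψ)
          + inner ℂ (ampL HC HA (Xop PC i) ψ) (ampR HC HA (Dzx PA i) ψ - ampR HC HA (Ezx PA i) ψ))
        + (inner ℂ (ampL HC HA (Zop PC i) ψ) (ampR HC HA (Dzy PA i) ψ + ampR HC HA (Ezy PA i) ψ)
          + inner ℂ (-ampL HC HA (Yop PC i) ψ)
              (ampR HC HA (Dzy PA i) ψ - ampR HC HA (Ezy PA i) ψ))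
        + (inner ℂ (ampL HC HA (Xop PC i) ψ) (ampR HC HA (Dxy PA i) ψ + ampR HC HA (Exy PA i) ψ)
          + inner ℂ (-ampL HC HA (Yop PC i) ψ)
              (ampR HC HA (Dxy PA i) ψ - ampR HC HA (Exy PA i) ψ)) := by
      have hZ : IsSelfAdjoint (Zop PC i) := hsc i 0
      have hX : IsSelfAdjoint (Xop PC i) := hsc i 1
      have hY : IsSelfAdjoint (Yop PC i) := hsc i 2
      rw [bellOp]
      simp only [add_apply, sub_apply, inner_add_right ψ, inner_sub_right ψ, inner_neg_left]
      rw [inner_hmap_of_isSelfAdjoint hZ,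
        inner_hmap_of_isSelfAdjoint hX, inner_hmap_of_isSelfAdjoint hZ,
        inner_hmap_of_isSelfAdjoint hY, inner_hmap_of_isSelfAdjoint hX,
        inner_hmap_of_isSelfAdjoint hY]
      simp only [map_add, map_sub, add_apply, sub_apply]
      ring
    rw [e, map_add, map_add (RCLike.re (K := ℂ))] at hBi
    replace hBi := hBi.trans (RCLike.ofReal_re (K := ℂ) (6 * √2))
    -- Three numbers, each at most `2√2`, that sum to `6√2` are all equal to `2√2`.
    have l1 := chsh_le (hnc i 0) (hnc i 1) (hna i 0) (hna i 1)
    have l2 := chsh_le (hnc i 0) hy (hna i 2) (hna i 3)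
    have l3 := chsh_le (hnc i 1) hy (hna i 4) (hna i 5)
    obtain ⟨z1, x1, d1, c1, c1'⟩ := chsh_eq (hnc i 0) (hnc i 1) (hna i 0) (hna i 1)
      (le_antisymm l1 (by unfold Zop Xop Yop Dzx Ezx Dzy Ezy Dxy Exy at *; linarith))
    obtain ⟨-, y1, d2, c2, c2'⟩ := chsh_eq (hnc i 0) hy (hna i 2) (hna i 3)
      (le_antisymm l2 (by unfold Zop Xop Yop Dzx Ezx Dzy Ezy Dxy Exy at *; linarith))
    obtain ⟨-, -, d3, c3, c3'⟩ := chsh_eq (hnc i 1) hy (hna i 4) (hna i 5)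
      (le_antisymm l3 (by unfold Zop Xop Yop Dzx Ezx Dzy Ezy Dxy Exy at *; linarith))
    rw [norm_neg] at y1
    simp only [map_add, map_sub, map_neg, add_apply, sub_apply, neg_apply]
    refine ⟨fun s => ?_, ⟨d1, d2, d3⟩, ⟨c1, c1'⟩, ⟨c2, c2'⟩, ⟨c3, c3'⟩⟩
    fin_cases s
    exacts [z1, x1, y1]
  have hcorr : ∀ i s, Correlated ψ (avgObs PC i s) (partnerObs PA i s) := by
    intro i s
    obtain ⟨-, -, ⟨h0, h1⟩, ⟨-, h2⟩, -⟩ := key i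
    fin_cases s
    · change ampL HC HA (Zop PC i) ψ = ampR HC HA ((((√2 : ℝ) : ℂ))⁻¹ • _) ψ
      rw [map_smul, smul_apply, ← h0, inv_smul_smul₀ hsqrt]
    · change ampL HC HA (Xop PC i) ψ = ampR HC HA ((((√2 : ℝ) : ℂ))⁻¹ • _) ψ
      rw [map_smul, smul_apply, ← h1, inv_smul_smul₀ hsqrt]
    · change ampL HC HA (Yop PC i) ψ = ampR HC HA (-((((√2 : ℝ) : ℂ))⁻¹ • _)) ψ
      rw [map_neg, map_smul, neg_apply, smul_apply, ← h2, inv_smul_smul₀ hsqrt, map_neg, neg_apply,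
        neg_neg]
  have hLR : ∀ (B : HA →L[ℂ] HA) (T : HC →L[ℂ] HC) (v : HTensor HC HA),
      ampL HC HA T (ampR HC HA B v) = ampR HC HA B (ampL HC HA T v) := fun B T v =>
    Correlated.ampL_ampR T B v
  have hRL : ∀ (B : HC →L[ℂ] HC) (T : HA →L[ℂ] HA) (v : HTensor HC HA),
      ampR HC HA T (ampL HC HA B v) = ampL HC HA B (ampR HC HA T v) := fun B T v =>
    (Correlated.ampL_ampR B T v).symm
  have hsq : ∀ i s, ampL HC HA (avgObs PC i s * avgObs PC i s) ψ = ψ := fun i s =>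
    map_avgObs_mul_self hPC _ hψ ((key i).1 s) (hLR _) (hcorr i s)
  -- Adding the two equations cancels `D'` and leaves `√2 (S + T)ψ = 2 D ψ`.
  have half : ∀ {S T : HC →L[ℂ] HC} {D D' : HA →L[ℂ] HA},
      ((√2 : ℝ) : ℂ) • ampL HC HA S ψ = ampR HC HA (D + D') ψ →
      ((√2 : ℝ) : ℂ) • ampL HC HA T ψ = ampR HC HA (D - D') ψ →
      Correlated ψ (S + T) (((√2 : ℝ) : ℂ) • D) := by
    intro S T D D' h1 h2
    have h3 : (((√2 : ℝ) : ℂ)) * (((√2 : ℝ) : ℂ)) = 2 := by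
      rw [← Complex.ofReal_mul, Real.mul_self_sqrt zero_le_two]; norm_num
    have h4 : ((√2 : ℝ) : ℂ) • ampL HC HA (S + T) ψ
        = ((√2 : ℝ) : ℂ) • ampR HC HA (((√2 : ℝ) : ℂ) • D) ψ := by
      rw [map_add, add_apply, smul_add, h1, h2, map_smul, smul_apply, smul_smul, h3, map_add,
        map_sub, add_apply, sub_apply, two_smul]
      abel
    exact smul_right_injective _ hsqrt h4
  have anti : ∀ {i : Fin n} {S T : HC →L[ℂ] HC} {D' : HA →L[ℂ] HA} (s : Fin 6),
      ampL HC HA (S * S) ψ = ψ → ampL HC HA (T * T) ψ = ψ →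
      ‖ampR HC HA (avgObs PA i s) ψ‖ = 1 →
      ((√2 : ℝ) : ℂ) • ampL HC HA S ψ = ampR HC HA (avgObs PA i s + D') ψ →
      ((√2 : ℝ) : ℂ) • ampL HC HA T ψ = ampR HC HA (avgObs PA i s - D') ψ →
      ampL HC HA (S * T + T * S) ψ = 0 := by
    intro i S T D' s hS hT hD h1 h2
    have h := half h1 h2
    refine anticomm_of_correlated hS hT ?_ h
    -- Alice's `D` squares to one on `ψ` for the same reason as Charlie's averages, with partner `(S
    -- + T)/√2`.
    refine map_avgObs_mul_self hPA _ hψ hD (hRL ((((√2 : ℝ) : ℂ))⁻¹ • (S + T))) ?_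
    rw [map_smul, smul_apply, show ampL HC HA (S + T) ψ = _ from h, map_smul, smul_apply,
      inv_smul_smul₀ hsqrt]
  have hyy : ∀ i, ampL HC HA (-Yop PC i * -Yop PC i) ψ = ψ := fun i => by
    rw [neg_mul_neg]; exact hsq i 2
  have neg_anti : ∀ {S T : HC →L[ℂ] HC}, ampL HC HA (S * -T + -T * S) ψ = 0 →
      ampL HC HA (S * T + T * S) ψ = 0 := by
    intro S T h
    rwa [mul_neg, neg_mul, ← neg_add, map_neg, neg_apply, neg_eq_zero] at h
  have hlt : ∀ i, ampL HC HA (avgObs PC i 0 * avgObs PC i 1 + avgObs PC i 1 * avgObs PC i 0) ψ = 0 ∧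
      ampL HC HA (avgObs PC i 0 * avgObs PC i 2 + avgObs PC i 2 * avgObs PC i 0) ψ = 0 ∧
      ampL HC HA (avgObs PC i 1 * avgObs PC i 2 + avgObs PC i 2 * avgObs PC i 1) ψ = 0 := by
    intro i
    obtain ⟨-, ⟨d1, d2, d3⟩, ⟨c1, c1'⟩, ⟨c2, c2'⟩, ⟨c3, c3'⟩⟩ := key i
    exact ⟨anti 0 (hsq i 0) (hsq i 1) d1 c1 c1', neg_anti (anti 2 (hsq i 0) (hyy i) d2 c2 c2'),
      neg_anti (anti 4 (hsq i 1) (hyy i) d3 c3 c3')⟩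
  refine ⟨hsc, fun i s => ?_, hcorr, hsq, fun i s t hst => ?_, fun i k s t hik => ?_⟩
  · have hr : ∀ T : HA →L[ℂ] HA, IsSelfAdjoint T → IsSelfAdjoint ((((√2 : ℝ) : ℂ))⁻¹ • T) := by
      intro T hT
      rw [IsSelfAdjoint, star_smul, hT.star_eq, ← Complex.ofReal_inv]
      congr 1
      exact Complex.conj_ofReal _
    fin_cases s
    exacts [hr _ ((hsa i 0).add (hsa i 1)), hr _ ((hsa i 0).sub (hsa i 1)),
      (hr _ ((hsa i 2).sub (hsa i 3))).neg]
  · obtain ⟨h01, h02, h12⟩ := hlt i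
    fin_cases s <;> fin_cases t
    exacts [absurd rfl hst, h01, h02, by rw [add_comm]; exact h01, absurd rfl hst, h12,
      by rw [add_comm]; exact h02, by rw [add_comm]; exact h12, absurd rfl hst]
  -- As `i ≠ k`, a single input can prescribe both entries.
  · obtain ⟨z, hz, hz'⟩ : ∃ z : Fin n → Fin 3, z i = s ∧ z k = t :=
      ⟨Function.update (fun _ => t) i s, by simp, by simp [hik.symm]⟩
    rw [map_sub, sub_apply,
      map_avgObs_mul_avgObs hPC _ hψ ((key i).1 s) ((key k).1 t) (hLR _) (hcorr k t) hz hz',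
      map_avgObs_mul_avgObs hPC _ hψ ((key k).1 t) ((key i).1 s) (hLR _) (hcorr i s) hz' hz,
      (commute_outcomeObs (hPC z) i k).eq, sub_self]

end BellViolation

end PauliSelfTest

theorem lemma2 {n : ℕ} {HC HA : Type*}
    [NormedAddCommGroup HC] [InnerProductSpace ℂ HC] [CompleteSpace HC]
    [NormedAddCommGroup HA] [InnerProductSpace ℂ HA] [CompleteSpace HA]
    (ψ : HTensor HC HA) (hψ : ‖ψ‖ = 1)
    (PC : (Fin n → Fin 3) → (Fin n → ℤˣ) → (HC →L[ℂ] HC))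
    (hPC : ∀ z, IsProjectiveMeasurement (PC z))
    (PA : (Fin n → Fin 6) → (Fin n → ℤˣ) → (HA →L[ℂ] HA))
    (hPA : ∀ x, IsProjectiveMeasurement (PA x))
    (hB : ∀ i : Fin n, inner ℂ ψ (bellOp PC PA i ψ) = ((6 * √2 : ℝ) : ℂ)) :
    ∃ UC ∈ unitary (Extended HC n →L[ℂ] Extended HC n),
    ∃ UA ∈ unitary (Extended HA n →L[ℂ] Extended HA n),
    ∃ ξ : HTensor (HTensor HC (Register n)) (HTensor HA (Register n)),
      ‖ξ‖ = 1 ∧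
      (∃ ξq : Bits n → HTensor HC HA, ξ = ∑ q, attach (ξq q) (ket₂ q q)) ∧
      hmap UC UA (withZeros n ψ) = attach ξ (phiPlusPow n) ∧
      ∀ j : Fin n,
        hmap UC UA (withZeros n (hmap (Zop PC j) (ContinuousLinearMap.id ℂ HA) ψ)) =
          onCharlieQubit σz j (attach ξ (phiPlusPow n)) ∧
        hmap UC UA (withZeros n (hmap (Xop PC j) (ContinuousLinearMap.id ℂ HA) ψ)) =
          onCharlieQubit σx j (attach ξ (phiPlusPow n)) ∧
        hmap UC UA (withZeros n (hmap (Yop PC j) (ContinuousLinearMap.id ℂ HA) ψ)) =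
          onCharlieQubit σy j (attach (onCharlieQubit σz j ξ) (phiPlusPow n)) :=
  (isCorrelatedPauli_of_bellOp hψ hPC hPA hB).exists_localUnitary hψ
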